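/- Let $k$ be a field and let $H$ be a Hopf algebra over $k$ that is semisimple as an algebra. Let $A$ be a (left) partial $H$-module algebra, i.e. a unital associative $k$-algebra with a $k$-linear map $H\otimes A\to A$, $h\otimes a\mapsto h\cdot a$, such that $1_H\cdot a=a$ and $h\cdot(a(g\cdot b))=\sum (h_1\cdot a)((h_2g)\cdot b)$ for all $a,b\in A$ and $h,g\in H$. A left partial $(A,H)$-module is a left $A$-module $M$ with a $k$-linear map $H\otimes M\to M$, $h\otimes m\mapsto h\triangleright m$, such that $1_H\triangleright m=m$ and $h\triangleright(a(g\triangleright m))=\sum (h_1\cdot a)((h_2g)\triangleright m)$; it is irreducible if $M\neq 0$ and its only $A$-submodules closed under $H$ are $0$ and $M$. A two-sided ideal $I$ of $A$ is $H$-stable if $H\cdot I\subseteq I$; an $H$-stable ideal $I$ is left $H$-primitive if the partial $H$-module algebra $A/I$ (with $h\cdot(a+I)=h\cdot a+I$) has a left partial $(A/I,H)$-module that is irreducible and has zero annihilator in $A/I$. The $H$-Jacobson radical $J_H(A)$ is the intersection of all left $H$-primitive ideals of $A$, and $A$ is $H$-semiprimitive if $J_H(A)=0$. The algebra $A$ is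 locally finite if every finitely generated subalgebra of $A$ is finite-dimensional over $k$. Let $A\# H$ be the vector space $A\otimes H$ with the multiplication $(a\# h)(b\# g)=\sum a(h_1\cdot b)\# h_2g$. The partial smash product $\underline{A\# H}=(A\# H)(1_A\# 1_H)$ is a unital algebra with identity $1_A\# 1_H$. **Theorem.** If $H$ is semisimple and $A$ is $H$-semiprimitive and locally finite, then the partial smash product $\underline{A\# H}$ is semiprimitive, i.e. its Jacobson radical is zero. -/

import Mathlib

open scoped TensorProduct

universe u v w

/-- A (left) partial action of a bialgebra (in particular, of a Hopf algebra) `H` on a unital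
`k`-algebra `A`: a `k`-linear map `h ⊗ a ↦ h · a` such that `1 · a = a` and
`h · (a (g · b)) = ∑ (h₁ · a) ((h₂ g) · b)`.  An algebra `A` together with such a datum is a
partial `H`-module algebra. -/
structure PartialAction (k : Type u) (H : Type v) (A : Type w) [Field k] [Ring H] [Bialgebra k H]
    [Ring A] [Algebra k A] where
  /-- The map `h ⊗ a ↦ h · a`. -/
  act : H →ₗ[k] A →ₗ[k] A
  one_act : ∀ a : A, act 1 a = a
  act_mul_act : ∀ (h g : H) (a b : A),
    act h (a * act g b) =
      LinearMap.mul' k A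
        (TensorProduct.map (act.flip a) (act.flip b ∘ₗ LinearMap.mulRight k g)
          (Coalgebra.comul (R := k) h))

namespace PartialAction

section Smash

variable {k : Type u} {H : Type v} {A : Type w} [Field k] [Ring H] [Bialgebra k H]
  [Ring A] [Algebra k A] (α : PartialAction k H A)

/-- The multiplication `(a # h)(b # g) = ∑ a (h₁ · b) # h₂ g` of the (nonunital) algebra `A # H`,
whose underlying vector space is `A ⊗ H`. -/
noncomputable def smashMul : A ⊗[k] H →ₗ[k] A ⊗[k] H →ₗ[k] A ⊗[k] H :=
  TensorProduct.lift <| LinearMap.mk₂ k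
    (fun a h => TensorProduct.lift <| LinearMap.mk₂ k
      (fun b g => TensorProduct.map (LinearMap.mulLeft k a ∘ₗ α.act.flip b)
        (LinearMap.mulRight k g) (Coalgebra.comul (R := k) h))
      (fun b b' g => by
        rw [map_add, LinearMap.comp_add, TensorProduct.map_add_left, LinearMap.add_apply])
      (fun c b g => by
        rw [map_smul, LinearMap.comp_smul, TensorProduct.map_smul_left, LinearMap.smul_apply])
      (fun b g g' => by
        rw [show LinearMap.mulRight k (g + g') = LinearMap.mulRight k g + LinearMap.mulRight k g'
          by ext; simp [mul_add], TensorProduct.map_add_right, LinearMap.add_apply])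
      (fun c b g => by
        rw [show LinearMap.mulRight k (c • g) = c • LinearMap.mulRight k g by ext; simp,
          TensorProduct.map_smul_right, LinearMap.smul_apply]))
    (fun a a' h => by
      ext b g
      simp [LinearMap.add_comp, TensorProduct.map_add_left,
        show LinearMap.mulLeft k (a + a') = LinearMap.mulLeft k a + LinearMap.mulLeft k a' by
          ext; simp [add_mul]])
    (fun c a h => by
      ext b g
      simp [LinearMap.smul_comp, TensorProduct.map_smul_left,
        show LinearMap.mulLeft k (c • a) = c • LinearMap.mulLeft k a by ext; simp])
    (fun a h h' => by ext b g; simp)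
    (fun c a h => by ext b g; simp)

theorem smashMul_tmul (a b : A) (h g : H) :
    α.smashMul (a ⊗ₜ[k] h) (b ⊗ₜ[k] g) =
      TensorProduct.map (LinearMap.mulLeft k a ∘ₗ α.act.flip b) (LinearMap.mulRight k g)
        (Coalgebra.comul (R := k) h) := by
  simp [smashMul]

/-- The element `1 # 1` is a left identity of `A # H`. -/
theorem one_smashMul (x : A ⊗[k] H) : α.smashMul (1 ⊗ₜ[k] 1) x = x := by
  induction x with
  | zero => simp
  | add x y hx hy => rw [map_add, hx, hy]
  | tmul b g => simp [smashMul_tmul, Algebra.TensorProduct.one_def, α.one_act]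

/-- Auxiliary map `u ⊗ (v ⊗ w) ↦ a (u · b) ((v p) · c) ⊗ w q l`, used for associativity. -/
noncomputable def assocAux (a b c : A) (p q l : H) : H ⊗[k] (H ⊗[k] H) →ₗ[k] A ⊗[k] H :=
  (LinearMap.mul' k A).rTensor H ∘ₗ (TensorProduct.assoc k A A H).symm.toLinearMap ∘ₗ
    TensorProduct.map (LinearMap.mulLeft k a ∘ₗ α.act.flip b)
      (TensorProduct.map (α.act.flip c ∘ₗ LinearMap.mulRight k p) (LinearMap.mulRight k (q * l)))

theorem assocAux_tmul (a b c : A) (p q l u v w : H) :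
    α.assocAux a b c p q l (u ⊗ₜ[k] (v ⊗ₜ[k] w)) =
      (a * α.act u b * α.act (v * p) c) ⊗ₜ[k] (w * (q * l)) := by
  simp only [assocAux, LinearMap.comp_apply, TensorProduct.map_tmul, LinearEquiv.coe_coe,
    TensorProduct.assoc_symm_tmul, LinearMap.rTensor_tmul, LinearMap.mul'_apply,
    LinearMap.mulLeft_apply, LinearMap.mulRight_apply, LinearMap.flip_apply]

theorem smashMul_assoc_left (a b c : A) (g l : H) (r : Coalgebra.Repr k g (H × H))
    (t : H ⊗[k] H) :
    α.smashMul (TensorProduct.map (LinearMap.mulLeft k a ∘ₗ α.act.flip b)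
      (LinearMap.mulRight k g) t) (c ⊗ₜ[k] l) =
    ∑ i ∈ r.index, α.assocAux a b c (r.left i) (r.right i) l
      ((Coalgebra.comul (R := k)).lTensor H t) := by
  induction t with
  | zero => simp
  | add x y hx hy => simp only [map_add, LinearMap.add_apply, hx, hy, Finset.sum_add_distrib]
  | tmul u v =>
    rw [TensorProduct.map_tmul, smashMul_tmul, LinearMap.mulRight_apply, Bialgebra.comul_mul,
      ← r.eq, Finset.mul_sum, map_sum]
    refine Finset.sum_congr rfl fun i _ => ?_
    rw [LinearMap.lTensor_tmul]
    induction Coalgebra.comul (R := k) v with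
    | zero => simp
    | add x y hx hy => rw [add_mul, map_add, hx, hy, TensorProduct.tmul_add, map_add]
    | tmul v w =>
      rw [assocAux_tmul, Algebra.TensorProduct.tmul_mul_tmul, TensorProduct.map_tmul]
      simp [mul_assoc]

theorem smashMul_assoc_right (a b c : A) (p q l : H) (t : H ⊗[k] H) :
    TensorProduct.map (LinearMap.mulLeft k a ∘ₗ α.act.flip (b * α.act p c))
      (LinearMap.mulRight k (q * l)) t =
    α.assocAux a b c p q l
      (TensorProduct.assoc k H H H ((Coalgebra.comul (R := k)).rTensor H t)) := by
  induction t with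
  | zero => simp
  | add x y hx hy => simp only [map_add, hx, hy]
  | tmul u w =>
    rw [TensorProduct.map_tmul, LinearMap.rTensor_tmul, LinearMap.comp_apply,
      LinearMap.flip_apply, α.act_mul_act]
    induction Coalgebra.comul (R := k) u with
    | zero => simp
    | add x y hx hy =>
      simp only [map_add, TensorProduct.add_tmul] at hx hy ⊢
      rw [hx, hy]
    | tmul u v =>
      rw [TensorProduct.assoc_tmul, assocAux_tmul]
      simp [mul_assoc]

theorem smashMul_assoc (x y z : A ⊗[k] H) :
    α.smashMul (α.smashMul x y) z = α.smashMul x (α.smashMul y z) := by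
  induction x with
  | zero => simp
  | add x x' hx hx' => simp only [map_add, LinearMap.add_apply, hx, hx']
  | tmul a h =>
  induction y with
  | zero => simp
  | add y y' hy hy' => simp only [map_add, LinearMap.add_apply, hy, hy']
  | tmul b g =>
  induction z with
  | zero => simp
  | add z z' hz hz' => simp only [map_add, hz, hz']
  | tmul c l =>
    have r := Coalgebra.Repr.arbitrary k g
    rw [smashMul_tmul, smashMul_tmul, α.smashMul_assoc_left a b c g l r, ← r.eq, map_sum, map_sum]
    refine Finset.sum_congr rfl fun i _ => ?_
    rw [TensorProduct.map_tmul, LinearMap.mulRight_apply, LinearMap.comp_apply,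
      LinearMap.flip_apply, LinearMap.mulLeft_apply, smashMul_tmul, smashMul_assoc_right,
      Coalgebra.coassoc_apply]

/-- The underlying space `(A # H)(1 # 1)` of the partial smash product. -/
noncomputable def partialSmashSubmodule : Submodule k (A ⊗[k] H) :=
  LinearMap.range (α.smashMul.flip (1 ⊗ₜ[k] 1))

/-- The partial smash product of `A` by `H`: the subspace `(A # H)(1 # 1)` of `A # H`, which is
a unital algebra under the multiplication of `A # H`, with identity element `1 # 1`. -/
def PartialSmash : Type (max v w) := α.partialSmashSubmodule

theorem smashMul_one_of_mem {x : A ⊗[k] H} (hx : x ∈ α.partialSmashSubmodule) :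
    α.smashMul x (1 ⊗ₜ[k] 1) = x := by
  obtain ⟨y, rfl⟩ := hx
  simp only [LinearMap.flip_apply]
  rw [smashMul_assoc, one_smashMul]

theorem smashMul_mem {x y : A ⊗[k] H} (hy : y ∈ α.partialSmashSubmodule) :
    α.smashMul x y ∈ α.partialSmashSubmodule :=
  ⟨α.smashMul x y, by rw [LinearMap.flip_apply, smashMul_assoc, α.smashMul_one_of_mem hy]⟩

theorem one_mem_partialSmashSubmodule :
    (1 ⊗ₜ[k] 1 : A ⊗[k] H) ∈ α.partialSmashSubmodule :=
  ⟨1 ⊗ₜ[k] 1, by rw [LinearMap.flip_apply, one_smashMul]⟩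

noncomputable instance : AddCommGroup α.PartialSmash :=
  inferInstanceAs (AddCommGroup α.partialSmashSubmodule)

noncomputable instance : Module k α.PartialSmash :=
  inferInstanceAs (Module k α.partialSmashSubmodule)

/-- The inclusion of the partial smash product into the vector space `A ⊗ H` of `A # H`. -/
def PartialSmash.val (x : α.PartialSmash) : A ⊗[k] H := Subtype.val x

noncomputable instance : Ring α.PartialSmash where
  __ := (inferInstance : AddCommGroup α.PartialSmash)
  mul x y := ⟨α.smashMul x.val y.val, α.smashMul_mem y.property⟩
  one := ⟨1 ⊗ₜ[k] 1, α.one_mem_partialSmashSubmodule⟩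
  mul_assoc x y z := Subtype.ext (α.smashMul_assoc x.val y.val z.val)
  one_mul x := Subtype.ext (α.one_smashMul x.val)
  mul_one x := Subtype.ext (α.smashMul_one_of_mem x.property)
  left_distrib x y z := Subtype.ext (map_add (α.smashMul x.val) y.val z.val)
  right_distrib x y z := Subtype.ext (LinearMap.map_add₂ α.smashMul x.val y.val z.val)
  zero_mul x := Subtype.ext (LinearMap.map_zero₂ α.smashMul x.val)
  mul_zero x := Subtype.ext (map_zero (α.smashMul x.val))

noncomputable instance : Algebra k α.PartialSmash :=
  Algebra.ofModule
    (fun c x y => Subtype.ext (LinearMap.map_smul₂ α.smashMul c x.val y.val))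
    (fun c x y => Subtype.ext (map_smul (α.smashMul x.val) c y.val))

end Smash

section Radical

variable {k : Type u} {H : Type v} {A : Type w} [Field k] [Ring H] [Bialgebra k H]
  [Ring A] [Algebra k A]

/-- A left ideal `I` of `A` is `H`-stable if `H · I ⊆ I`. -/
def IsStable (α : PartialAction k H A) (I : Ideal A) : Prop :=
  ∀ (h : H), ∀ x ∈ I, α.act h x ∈ I

/-- The map `a + I ↦ (h · a) + I` on the quotient by an `H`-stable ideal. -/
noncomputable def quotientAct (α : PartialAction k H A) (I : Ideal A) [I.IsTwoSided]
    (hI : α.IsStable I) (h : H) : A ⧸ I →ₗ[k] A ⧸ I :=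
  (Submodule.Quotient.restrictScalarsEquiv k I).toLinearMap ∘ₗ
    (I.restrictScalars k).mapQ (I.restrictScalars k) (α.act h) (fun x hx => hI h x hx) ∘ₗ
    (Submodule.Quotient.restrictScalarsEquiv k I).symm.toLinearMap

theorem quotientAct_mk (α : PartialAction k H A) (I : Ideal A) [I.IsTwoSided]
    (hI : α.IsStable I) (h : H) (x : A) :
    α.quotientAct I hI h (Ideal.Quotient.mk I x) = Ideal.Quotient.mk I (α.act h x) := rfl

/-- The partial action `h · (a + I) = (h · a) + I` induced on the quotient by an `H`-stable
two-sided ideal. -/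
noncomputable def quotient (α : PartialAction k H A) (I : Ideal A) [I.IsTwoSided]
    (hI : α.IsStable I) : PartialAction k H (A ⧸ I) where
  act :=
    { toFun := α.quotientAct I hI
      map_add' := fun h g => LinearMap.ext fun x => by
        obtain ⟨x, rfl⟩ := Ideal.Quotient.mk_surjective x
        rw [LinearMap.add_apply, quotientAct_mk, quotientAct_mk, quotientAct_mk, map_add,
          LinearMap.add_apply, map_add]
      map_smul' := fun c h => LinearMap.ext fun x => by
        obtain ⟨x, rfl⟩ := Ideal.Quotient.mk_surjective x
        rw [LinearMap.smul_apply, quotientAct_mk, quotientAct_mk, map_smul, LinearMap.smul_apply]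
        rfl }
  one_act x := by
    obtain ⟨x, rfl⟩ := Ideal.Quotient.mk_surjective x
    exact congrArg (Ideal.Quotient.mk I) (α.one_act x)
  act_mul_act h g a b := by
    obtain ⟨a, rfl⟩ := Ideal.Quotient.mk_surjective a
    obtain ⟨b, rfl⟩ := Ideal.Quotient.mk_surjective b
    refine (congrArg (Ideal.Quotient.mk I) (α.act_mul_act h g a b)).trans ?_
    induction Coalgebra.comul (R := k) h with
    | zero => rw [map_zero, map_zero, map_zero, map_zero, map_zero]
    | add x y hx hy => rw [map_add, map_add, map_add, map_add, map_add, hx, hy]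
    | tmul u v =>
      rw [TensorProduct.map_tmul, TensorProduct.map_tmul, LinearMap.mul'_apply,
        LinearMap.mul'_apply, map_mul]
      rfl

/-- The `H`-part of a left partial `(A, H)`-module structure on a left `A`-module `M`: a
`k`-linear map `h ⊗ m ↦ h ▹ m` such that `1 ▹ m = m` and
`h ▹ (a (g ▹ m)) = ∑ (h₁ · a) ((h₂ g) ▹ m)`. -/
structure LeftModule (α : PartialAction k H A) (M : Type*) [AddCommGroup M] [Module k M]
    [Module A M] [IsScalarTower k A M] where
  /-- The map `h ⊗ m ↦ h ▹ m`. -/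
  act : H →ₗ[k] M →ₗ[k] M
  one_act : ∀ m : M, act 1 m = m
  act_smul_act : ∀ (h g : H) (a : A) (m : M),
    act h (a • act g m) =
      TensorProduct.lift (Algebra.lsmul k k M).toLinearMap
        (TensorProduct.map (α.act.flip a) (act.flip m ∘ₗ LinearMap.mulRight k g)
          (Coalgebra.comul (R := k) h))

/-- A left partial `(A, H)`-module is irreducible if it is nonzero and its only partial
`(A, H)`-submodules are `0` and itself. -/
def LeftModule.IsIrreducible {α : PartialAction k H A} {M : Type*} [AddCommGroup M] [Module k M]
    [Module A M] [IsScalarTower k A M] (ρ : α.LeftModule M) : Prop :=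
  Nontrivial M ∧
    ∀ N : Submodule A M, (∀ (h : H), ∀ m ∈ N, ρ.act h m ∈ N) → N = ⊥ ∨ N = ⊤

/-- `A` is left `H`-primitive if it has a faithful irreducible left partial `(A, H)`-module.
Irreducible partial modules are cyclic over the partial smash product, so the universe of `A ⊗ H`
contains all of them up to isomorphism. -/
def IsLeftPrimitive (α : PartialAction k H A) : Prop :=
  ∃ (M : Type (max v w)) (_ : AddCommGroup M) (_ : Module k M) (_ : Module A M)
    (_ : IsScalarTower k A M) (ρ : α.LeftModule M),
    ρ.IsIrreducible ∧ Module.annihilator A M = ⊥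

/-- An `H`-stable two-sided ideal `I` of `A` is left `H`-primitive if the partial `H`-module
algebra `A / I` is left `H`-primitive. -/
def IsLeftPrimitiveIdeal (α : PartialAction k H A) (I : Ideal A) : Prop :=
  ∃ (_ : I.IsTwoSided) (hI : α.IsStable I), (α.quotient I hI).IsLeftPrimitive

/-- The `H`-Jacobson radical `J_H(A)`: the intersection of all left `H`-primitive ideals. -/
def jacobson (α : PartialAction k H A) : Ideal A :=
  sInf {I : Ideal A | α.IsLeftPrimitiveIdeal I}

/-- The partial `H`-module algebra `A` is `H`-semiprimitive if `J_H(A) = 0`. -/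
def IsSemiprimitive (α : PartialAction k H A) : Prop := α.jacobson = ⊥

end Radical

end PartialAction

/-- A `k`-algebra is locally finite if each of its finitely generated subalgebras is
finite-dimensional. -/
def IsLocallyFiniteAlgebra (k : Type u) (A : Type w) [Field k] [Ring A] [Algebra k A] : Prop :=
  ∀ s : Finset A, Module.Finite k (Algebra.adjoin k (s : Set A))

/-! Write R for the partial smash product and J for its Jacobson radical. R is a right H-comodule
algebra under a # h ↦ (a # h₁) ⊗ h₂, and the heart of the matter is that J is stable under this
coaction (`Coaction.coeff_mem_jacobson`). Given stability, x ↦ x₀ (1 # S(x₁))(1 # 1) carries x ∈ J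
to an element of J that comes from (id ⊗ ε)(x) ∈ A. An irreducible partial module over A/I is a
simple R-module, so J kills it; hence an element of A lying in J belongs to J_H(A) = 0
(`mem_jacobson_of_toSmash_mem`). Thus id ⊗ ε vanishes on J. Applied to the coefficients of x, which
are again in J, this gives (id ⊗ f)(x) = 0 for every functional f, so x = 0
(`jacobson_eq_bot_of_stable`).

Stability reduces to finite dimension: a semisimple H is finite-dimensional, R is then locally
finite, and membership in J can be tested inside finite-dimensional stable subalgebras. So let R be
a finite-dimensional comodule algebra, V a simple module and I its core, the set of x all of whose
coefficients kill V; equivalently I is the annihilator of V ⊗ H. The claim is J ⊆ I. Choose a simple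
W maximizing a/b, where a = dim Hom(V ⊗ H, W) and b = dim W. Comparing maps to simple modules gives
a surjection from R^a onto (V ⊗ H)^b. As V ⊗ H is a Hopf module, dim Hom(V ⊗ H, Hom(H, W)) ≥ a · dim
H, and counting dimensions shows that every map R^a → Hom(H, W) factors through this surjection.
Since V embeds into Hom(H, W), the kernel lies in I^a, so (V ⊗ H)^b ≅ (R/I)^a
(`exists_surjective_pi_tensor`). A normalized integral makes V a direct summand of V ⊗ H, hence
projective over R/I (`exists_section_of_surjective`). Every simple R/I-module has its core inside I
(`IsCoreElement.of_simple`), so it is projective over R/I too. Therefore R/I is semisimple and J ⊆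
I. -/

/-! ### Contracting a tensor against functionals. -/

section Contract

variable {k X Y : Type*} [Field k] [AddCommGroup X] [Module k X] [AddCommGroup Y] [Module k Y]

/-- The contraction `x ⊗ y ↦ f y • x` of the second tensor factor against a functional. -/
noncomputable def TensorProduct.contractSnd (X : Type*) [AddCommGroup X] [Module k X]
    (f : Module.Dual k Y) : X ⊗[k] Y →ₗ[k] X :=
  (TensorProduct.rid k X).toLinearMap ∘ₗ f.lTensor X

@[simp]
theorem TensorProduct.contractSnd_tmul (f : Module.Dual k Y) (x : X) (y : Y) :
    TensorProduct.contractSnd X f (x ⊗ₜ y) = f y • x := by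
  simp [TensorProduct.contractSnd]

/-- Contractions against the coordinate functionals of a basis of Y are the coordinates of t over
that basis. -/
theorem TensorProduct.eq_zero_of_contractSnd (t : X ⊗[k] Y)
    (h : ∀ f : Module.Dual k Y, TensorProduct.contractSnd X f t = 0) : t = 0 := by
  classical
  let b := Module.Basis.ofVectorSpace k Y
  apply (TensorProduct.equivFinsuppOfBasisRight (M := X) b).injective
  ext i
  rw [map_zero, Finsupp.zero_apply, ← h (b.coord i)]
  clear h
  induction t with
  | zero => simp
  | add x y hx hy => simp only [map_add, Finsupp.add_apply, hx, hy]
  | tmul x y =>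
    rw [TensorProduct.equivFinsuppOfBasisRight_apply_tmul_apply,
      TensorProduct.contractSnd_tmul, Module.Basis.coord_apply]

end Contract

/-! ### Integrals of semisimple Hopf algebras, finite dimension and the antipode. -/

namespace HopfAlgebra

variable {k : Type u} {H : Type v} [Field k] [Ring H] [HopfAlgebra k H]

/-- A left integral of a Hopf algebra normalized by `ε(Λ) = 1`. -/
structure IsNormalizedLeftIntegral (Λ : H) : Prop where
  mul_eq : ∀ h : H, h * Λ = Coalgebra.counit (R := k) h • Λ
  counit_eq : Coalgebra.counit (R := k) Λ = 1

-- Semisimplicity gives the left ideal ker ε a complement L. The L-component Λ of 1 has ε(Λ) = 1,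
-- and hΛ - ε(h)Λ lies in both L and ker ε.
variable (k H) in
theorem exists_isNormalizedLeftIntegral [IsSemisimpleRing H] :
    ∃ Λ : H, IsNormalizedLeftIntegral (k := k) Λ := by
  let K : Ideal H := RingHom.ker (Bialgebra.counitAlgHom k H)
  obtain ⟨L, hL⟩ := exists_isCompl K
  obtain ⟨e, he, Λ, hΛ, h1⟩ := Submodule.mem_sup.1
    (show (1 : H) ∈ K ⊔ L by rw [hL.sup_eq_top]; trivial)
  have hK : ∀ x : H, x ∈ K ↔ Coalgebra.counit (R := k) x = 0 := fun x => Iff.rfl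
  have hc : Coalgebra.counit (R := k) Λ = 1 := by
    have := congrArg (Coalgebra.counit (R := k)) h1
    rwa [map_add, (hK e).1 he, zero_add, Bialgebra.counit_one] at this
  refine ⟨Λ, fun h => ?_, hc⟩
  have hm : h * Λ - Coalgebra.counit (R := k) h • Λ ∈ K ⊓ L := by
    refine ⟨(hK _).2 ?_, L.sub_mem (L.smul_mem h hΛ) ?_⟩
    · rw [map_sub, Bialgebra.counit_mul, map_smul, hc, smul_eq_mul, sub_self]
    · rw [Algebra.smul_def]
      exact L.smul_mem _ hΛ
  rw [hL.inf_eq_bot, Submodule.mem_bot] at hm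
  exact sub_eq_zero.1 hm

/-- Both sides equal (S(h₁) ⊗ 1) Δ(h₂) Δ(Λ): collapse S(h₁)h₂ for the left one, and use h₂Λ = ε(h₂)Λ
for the right one. -/
theorem IsNormalizedLeftIntegral.mul_comul {Λ : H} (hΛ : IsNormalizedLeftIntegral (k := k) Λ)
    (h : H) :
    (1 ⊗ₜ[k] h) * Coalgebra.comul (R := k) Λ =
      (antipode k h ⊗ₜ[k] 1) * Coalgebra.comul (R := k) Λ := by
  set t := Coalgebra.comul (R := k) Λ with ht
  let K : H ⊗[k] (H ⊗[k] H) →ₗ[k] H ⊗[k] H :=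
    LinearMap.mul' k (H ⊗[k] H) ∘ₗ TensorProduct.map
      ((TensorProduct.mk k H H).flip 1 ∘ₗ antipode k) (LinearMap.mulRight k t)
  have hK : ∀ a z, K (a ⊗ₜ z) = (antipode k a ⊗ₜ[k] 1) * (z * t) := fun a z => by simp [K]
  have h1 : ∀ z : H ⊗[k] H, K (Coalgebra.comul.lTensor H z) =
      (antipode k (TensorProduct.contractSnd H (Coalgebra.counit (R := k)) z) ⊗ₜ[k] 1) * t := by
    intro z
    induction z with
    | zero => simp
    | add x y hx hy => simp only [map_add, hx, hy, TensorProduct.add_tmul, add_mul]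
    | tmul a b =>
      rw [LinearMap.lTensor_tmul, hK, ht, ← Bialgebra.comul_mul, hΛ.mul_eq, map_smul,
        TensorProduct.contractSnd_tmul, map_smul, ← TensorProduct.smul_tmul',
        smul_mul_assoc, mul_smul_comm]
  have h2 : ∀ z : H ⊗[k] H,
      K (TensorProduct.assoc k H H H (Coalgebra.comul.rTensor H z)) =
      (1 ⊗ₜ[k] (TensorProduct.lid k H ((Coalgebra.counit (R := k)).rTensor H z))) * t := by
    intro z
    induction z with
    | zero => simp
    | add x y hx hy => simp only [map_add, hx, hy, TensorProduct.tmul_add, add_mul]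
    | tmul a b =>
      rw [LinearMap.rTensor_tmul, LinearMap.rTensor_tmul, TensorProduct.lid_tmul]
      have h3 : ∀ s : H ⊗[k] H, K (TensorProduct.assoc k H H H (s ⊗ₜ[k] b)) =
          (LinearMap.mul' k H ((antipode k).rTensor H s) ⊗ₜ[k] b) * t := by
        intro s
        induction s with
        | zero => simp
        | add x y hx hy => simp only [map_add, hx, hy, TensorProduct.add_tmul, add_mul]
        | tmul c d =>
          rw [TensorProduct.assoc_tmul, hK, ← mul_assoc, Algebra.TensorProduct.tmul_mul_tmul,
            one_mul, LinearMap.rTensor_tmul, LinearMap.mul'_apply]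
      rw [h3, mul_antipode_rTensor_comul_apply, Algebra.algebraMap_eq_smul_one,
        TensorProduct.smul_tmul]
  have h4 := h1 (Coalgebra.comul h)
  rw [← Coalgebra.coassoc_apply, h2, Coalgebra.rTensor_counit_comul, TensorProduct.lid_tmul,
    one_smul] at h4
  rw [h4, TensorProduct.contractSnd, LinearMap.comp_apply, Coalgebra.lTensor_counit_comul]
  simp

/-- The left coefficient space `{f(Λ₁) Λ₂}` of `Λ` is the whole algebra. -/
theorem IsNormalizedLeftIntegral.exists_coeff {Λ : H}
    (hΛ : IsNormalizedLeftIntegral (k := k) Λ) (h : H) :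
    ∃ f : Module.Dual k H, TensorProduct.contractSnd H f
      (TensorProduct.comm k H H (Coalgebra.comul (R := k) Λ)) = h := by
  set t := Coalgebra.comul (R := k) Λ with ht
  have hcomm : ∀ (f : Module.Dual k H) (a : H) (s : H ⊗[k] H),
      a * TensorProduct.contractSnd H f (TensorProduct.comm k H H s) =
      TensorProduct.contractSnd H f (TensorProduct.comm k H H ((1 ⊗ₜ[k] a) * s)) := by
    intro f a s
    induction s with
    | zero => simp
    | add x y hx hy => simp only [map_add, mul_add, hx, hy]
    | tmul c d => simp
  have hcomm' : ∀ (f : Module.Dual k H) (a : H) (s : H ⊗[k] H),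
      TensorProduct.contractSnd H (f ∘ₗ LinearMap.mulLeft k a) (TensorProduct.comm k H H s) =
      TensorProduct.contractSnd H f (TensorProduct.comm k H H ((a ⊗ₜ[k] 1) * s)) := by
    intro f a s
    induction s with
    | zero => simp
    | add x y hx hy => simp only [map_add, mul_add, hx, hy]
    | tmul c d => simp
  -- The coefficient space is a left ideal because a f(Λ₁)Λ₂ = f(S(a)Λ₁)Λ₂.
  let U : Submodule H H :=
    { carrier := {x | ∃ f : Module.Dual k H,
        TensorProduct.contractSnd H f (TensorProduct.comm k H H t) = x}
      add_mem' := by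
        rintro _ _ ⟨f, rfl⟩ ⟨g, rfl⟩
        refine ⟨f + g, ?_⟩
        simp [TensorProduct.contractSnd, LinearMap.lTensor_add]
      zero_mem' := ⟨0, by simp [TensorProduct.contractSnd]⟩
      smul_mem' := by
        rintro a _ ⟨f, rfl⟩
        exact ⟨f ∘ₗ LinearMap.mulLeft k (antipode k a), by
          rw [smul_eq_mul, hcomm, ht, hΛ.mul_comul, hcomm']⟩ }
  -- Δ(Λ) lies in H ⊗ U, checked by contracting its image modulo U.
  have h0 : ((U.mkQ.restrictScalars k).lTensor H) t = 0 := by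
    apply (TensorProduct.comm k H (H ⧸ U)).injective
    rw [map_zero]
    apply TensorProduct.eq_zero_of_contractSnd
    intro f
    have : ∀ s : H ⊗[k] H, TensorProduct.contractSnd (H ⧸ U) f
        (TensorProduct.comm k H (H ⧸ U) (((U.mkQ.restrictScalars k).lTensor H) s)) =
        U.mkQ (TensorProduct.contractSnd H f (TensorProduct.comm k H H s)) := by
      intro s
      induction s with
      | zero => simp
      | add x y hx hy => simp only [map_add, hx, hy]
      | tmul c d =>
        simp only [LinearMap.lTensor_tmul, TensorProduct.comm_tmul,
          TensorProduct.contractSnd_tmul]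
        exact ((U.mkQ.restrictScalars k).map_smul (f c) d).symm
    rw [this, Submodule.mkQ_apply, Submodule.Quotient.mk_eq_zero]
    exact ⟨f, rfl⟩
  let B : H ⊗[k] (H ⧸ U) →ₗ[k] H ⧸ U :=
    TensorProduct.lift ((Algebra.lsmul k k (H ⧸ U)).toLinearMap ∘ₗ antipode k)
  have hB : ∀ s : H ⊗[k] H, B (((U.mkQ.restrictScalars k).lTensor H) s) =
      U.mkQ (LinearMap.mul' k H ((antipode k).rTensor H s)) := by
    intro s
    induction s with
    | zero => simp
    | add x y hx hy => simp only [map_add, hx, hy]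
    | tmul c d =>
      simp only [LinearMap.lTensor_tmul, LinearMap.rTensor_tmul, LinearMap.mul'_apply, B,
        TensorProduct.lift.tmul]
      exact ((U.mkQ).map_smul (antipode k c) d).symm
  -- Apply S(Λ₁)Λ₂ = ε(Λ) = 1 with Λ₂ taken from the left ideal U.
  have h1 : (1 : H) ∈ U := by
    have := hB t
    rw [h0, map_zero, ht, mul_antipode_rTensor_comul_apply, hΛ.counit_eq, map_one,
      Submodule.mkQ_apply] at this
    exact (Submodule.Quotient.mk_eq_zero U).1 this.symm
  have h2 := U.smul_mem h h1
  rwa [smul_eq_mul, mul_one] at h2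

variable (k H) in
/-- A semisimple Hopf algebra is finite-dimensional. -/
theorem finite_of_isSemisimpleRing [IsSemisimpleRing H] : Module.Finite k H := by
  obtain ⟨Λ, hΛ⟩ := exists_isNormalizedLeftIntegral k H
  obtain ⟨s, hs⟩ := TensorProduct.exists_finset (Coalgebra.comul (R := k) Λ)
  classical
  refine ⟨⟨s.image Prod.snd, ?_⟩⟩
  rw [eq_top_iff]
  rintro h -
  -- Every h is f(Λ₁)Λ₂, so the finitely many second legs of Δ(Λ) span.
  obtain ⟨f, rfl⟩ := hΛ.exists_coeff h
  rw [hs, map_sum, map_sum]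
  refine Submodule.sum_mem _ fun i hi => ?_
  rw [TensorProduct.comm_tmul, TensorProduct.contractSnd_tmul]
  exact Submodule.smul_mem _ _ (Submodule.subset_span (by
    simp only [Finset.coe_image]; exact ⟨i, hi, rfl⟩))

variable (k H) in
/-- The antipode of a semisimple Hopf algebra is injective. -/
theorem antipode_injective_of_isSemisimpleRing [IsSemisimpleRing H] :
    Function.Injective (antipode k : H →ₗ[k] H) := by
  obtain ⟨Λ, hΛ⟩ := exists_isNormalizedLeftIntegral k H
  rw [injective_iff_map_eq_zero]
  intro h hh
  have h0 : (1 ⊗ₜ[k] h) * Coalgebra.comul (R := k) Λ = 0 := by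
    rw [hΛ.mul_comul, hh, TensorProduct.zero_tmul, zero_mul]
  -- With 1 = f(Λ₁)Λ₂ one gets h = f(Λ₁)hΛ₂ = f(S(h)Λ₁)Λ₂ = 0.
  obtain ⟨f, hf⟩ := hΛ.exists_coeff 1
  have : ∀ s : H ⊗[k] H,
      h * TensorProduct.contractSnd H f (TensorProduct.comm k H H s) =
      TensorProduct.contractSnd H f (TensorProduct.comm k H H ((1 ⊗ₜ[k] h) * s)) := by
    intro s
    induction s with
    | zero => simp
    | add x y hx hy => simp only [map_add, mul_add, hx, hy]
    | tmul c d => simp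
  rw [← mul_one h, ← hf, this, h0, map_zero, map_zero]

end HopfAlgebra

/-! ### Comparing finite-dimensional modules by their maps to simple modules. -/

section FiniteDimensional

variable (k : Type*) {R : Type*} [Field k] [Ring R] [Algebra k R]

theorem LinearMap.finite_of_isScalarTower (M N : Type*) [AddCommGroup M] [Module k M] [Module R M]
    [IsScalarTower k R M] [AddCommGroup N] [Module k N] [Module R N] [IsScalarTower k R N]
    [Module.Finite k M] [Module.Finite k N] : Module.Finite k (M →ₗ[R] N) :=
  Module.Finite.of_injective (LinearMap.restrictScalarsₗ k R M N k)
    (LinearMap.restrictScalars_injective k)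

theorem Submodule.finite_quotient_of_isScalarTower {M : Type*} [AddCommGroup M] [Module k M]
    [Module R M] [IsScalarTower k R M] [Module.Finite k M] (P : Submodule R M) :
    Module.Finite k (M ⧸ P) :=
  Module.Finite.of_surjective (P.mkQ.restrictScalars k) P.mkQ_surjective

theorem LinearMap.finrank_hom_of_isCompl {M T : Type*} [AddCommGroup M] [Module k M]
    [Module R M] [IsScalarTower k R M] [AddCommGroup T] [Module k T] [Module R T]
    [IsScalarTower k R T] [Module.Finite k M] [Module.Finite k T] {S S' : Submodule R M}
    (h : IsCompl S S') : Module.finrank k (M →ₗ[R] T) =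
      Module.finrank k (S →ₗ[R] T) + Module.finrank k (S' →ₗ[R] T) := by
  have : Module.Finite k S := inferInstanceAs (Module.Finite k (S.restrictScalars k))
  have : Module.Finite k S' := inferInstanceAs (Module.Finite k (S'.restrictScalars k))
  have := LinearMap.finite_of_isScalarTower (R := R) k S T
  have := LinearMap.finite_of_isScalarTower (R := R) k S' T
  rw [← Module.finrank_prod]
  exact LinearEquiv.finrank_eq ((LinearEquiv.congrLeft T k
    (Submodule.prodEquivOfIsCompl S S' h).symm).trans (LinearMap.coprodEquiv k).symm)

/-- The dimension of Hom into a simple module measures its multiplicity. A simple summand of M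
therefore also occurs in N; it is split off both modules and induction on dim M handles the
complements. -/
theorem LinearMap.exists_surjective_of_isSemisimpleModule [Module.Finite k R]
    {M N : Type*} [AddCommGroup M] [Module k M]
    [Module R M] [IsScalarTower k R M] [AddCommGroup N] [Module k N] [Module R N]
    [IsScalarTower k R N] [Module.Finite k M] [Module.Finite k N]
    [IsSemisimpleModule R M] [IsSemisimpleModule R N]
    (h : ∀ 𝔪 : Ideal R, 𝔪.IsMaximal →
      Module.finrank k (M →ₗ[R] R ⧸ 𝔪) ≤ Module.finrank k (N →ₗ[R] R ⧸ 𝔪)) :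
    ∃ f : N →ₗ[R] M, Function.Surjective f := by
  induction hn : Module.finrank k M using Nat.strong_induction_on generalizing M N with
  | _ n ih =>
  subst hn
  cases subsingleton_or_nontrivial M with
  | inl _ => exact ⟨0, fun x => ⟨0, Subsingleton.elim _ _⟩⟩
  | inr _ =>
  obtain ⟨S, hS⟩ := IsSemisimpleModule.exists_simple_submodule R M
  have hSn : Nontrivial S := IsSimpleModule.nontrivial R S
  obtain ⟨M', hM'⟩ := exists_isCompl S
  obtain ⟨𝔪, h𝔪, ⟨e⟩⟩ := isSimpleModule_iff_quot_maximal.1 hS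
  have hsimp : IsSimpleModule R (R ⧸ 𝔪) := isSimpleModule_iff_isCoatom.2 h𝔪.out
  have hq : Module.Finite k (R ⧸ 𝔪) := Submodule.finite_quotient_of_isScalarTower k 𝔪
  have hf1 := LinearMap.finite_of_isScalarTower (R := R) k M (R ⧸ 𝔪)
  have hf2 := LinearMap.finite_of_isScalarTower (R := R) k N (R ⧸ 𝔪)
  have hp : 0 < Module.finrank k (N →ₗ[R] R ⧸ 𝔪) := by
    refine lt_of_lt_of_le ?_ (h 𝔪 h𝔪)
    rw [Module.finrank_pos_iff_exists_ne_zero]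
    refine ⟨e.toLinearMap ∘ₗ S.projectionOnto M' hM', fun h0 => ?_⟩
    obtain ⟨x, hx⟩ := exists_ne (0 : S)
    apply hx
    have := LinearMap.congr_fun h0 (x : M)
    simpa using this
  obtain ⟨p, hp0⟩ := (Module.finrank_pos_iff_exists_ne_zero).1 hp
  have hps := LinearMap.surjective_of_ne_zero hp0
  obtain ⟨T, hT⟩ := exists_isCompl (LinearMap.ker p)
  have eT : T ≃ₗ[R] S := ((Submodule.quotientEquivOfIsCompl _ T hT).symm.trans
    (p.quotKerEquivOfSurjective hps)).trans e.symm
  have : Module.Finite k M' := inferInstanceAs (Module.Finite k (M'.restrictScalars k))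
  have : Module.Finite k (LinearMap.ker p) :=
    inferInstanceAs (Module.Finite k ((LinearMap.ker p).restrictScalars k))
  have hlt : Module.finrank k M' < Module.finrank k M := by
    have hne : M'.restrictScalars k ≠ ⊤ := fun htop => by
      have h1 : M' = ⊤ := (Submodule.restrictScalars_eq_top_iff k R M).1 htop
      have h2 : S = ⊥ := by simpa [h1] using hM'.inf_eq_bot
      obtain ⟨x, hx⟩ := exists_ne (0 : S)
      exact hx (Subtype.ext ((Submodule.mem_bot R).1 (h2 ▸ x.2)))
    exact Submodule.finrank_lt hne
  -- The removed summands S and T are isomorphic, so both Hom dimensions drop by the same amount.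
  obtain ⟨f, hf⟩ := ih _ hlt (M := M') (N := LinearMap.ker p) (fun 𝔫 h𝔫 => by
    have : Module.Finite k (R ⧸ 𝔫) := Submodule.finite_quotient_of_isScalarTower k 𝔫
    have h1 := h 𝔫 h𝔫
    rw [LinearMap.finrank_hom_of_isCompl k hM', LinearMap.finrank_hom_of_isCompl k hT,
      (LinearEquiv.congrLeft (R ⧸ 𝔫) k eT).finrank_eq] at h1
    omega) rfl
  refine ⟨(Submodule.prodEquivOfIsCompl _ _ hM').toLinearMap ∘ₗ
    (LinearMap.prodMap eT.toLinearMap f) ∘ₗ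
    (Submodule.prodEquivOfIsCompl _ _ hT.symm).symm.toLinearMap, ?_⟩
  simp only [LinearMap.coe_comp, LinearEquiv.coe_coe]
  refine (LinearEquiv.surjective _).comp (Function.Surjective.comp ?_ (LinearEquiv.surjective _))
  exact Prod.map_surjective.2 ⟨eT.surjective, hf⟩

/-- A finite-dimensional module is a quotient of a projective module that has at least as many
maps to each simple module. -/
theorem LinearMap.exists_surjective_of_projective [Module.Finite k R]
    {M N : Type*} [AddCommGroup M] [Module k M]
    [Module R M] [IsScalarTower k R M] [AddCommGroup N] [Module k N] [Module R N]
    [IsScalarTower k R N] [Module.Finite k M] [Module.Finite k N]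
    [Module.Projective R N]
    (h : ∀ 𝔪 : Ideal R, 𝔪.IsMaximal →
      Module.finrank k (M →ₗ[R] R ⧸ 𝔪) ≤ Module.finrank k (N →ₗ[R] R ⧸ 𝔪)) :
    ∃ f : N →ₗ[R] M, Function.Surjective f := by
  have hRM : Module.Finite R M := Module.Finite.of_restrictScalars_finite k R M
  have h1 : Module.Finite k (M ⧸ Module.jacobson R M) :=
    Submodule.finite_quotient_of_isScalarTower k _
  have h2 : Module.Finite k (N ⧸ Module.jacobson R N) :=
    Submodule.finite_quotient_of_isScalarTower k _
  have : IsArtinian R (M ⧸ Module.jacobson R M) := isArtinian_of_tower k inferInstance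
  have : IsArtinian R (N ⧸ Module.jacobson R N) := isArtinian_of_tower k inferInstance
  have : IsSemisimpleModule R (M ⧸ Module.jacobson R M) :=
    (IsArtinian.isSemisimpleModule_iff_jacobson R _).2 (Module.jacobson_quotient_jacobson R M)
  have : IsSemisimpleModule R (N ⧸ Module.jacobson R N) :=
    (IsArtinian.isSemisimpleModule_iff_jacobson R _).2 (Module.jacobson_quotient_jacobson R N)
  -- The semisimple tops are compared first: every map to a simple module factors through the top,
  -- so the inequalities pass to the quotients.
  obtain ⟨g, hg⟩ := LinearMap.exists_surjective_of_isSemisimpleModule (R := R) k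
    (M := M ⧸ Module.jacobson R M) (N := N ⧸ Module.jacobson R N) (fun 𝔪 h𝔪 => by
      have hsimp : IsSimpleModule R (R ⧸ 𝔪) := isSimpleModule_iff_isCoatom.2 h𝔪.out
      have hq : Module.Finite k (R ⧸ 𝔪) := Submodule.finite_quotient_of_isScalarTower k 𝔪
      have := LinearMap.finite_of_isScalarTower (R := R) k M (R ⧸ 𝔪)
      have := LinearMap.finite_of_isScalarTower (R := R) k
        (N ⧸ Module.jacobson R N) (R ⧸ 𝔪)
      refine le_trans ?_ ((h 𝔪 h𝔪).trans ?_)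
      · refine LinearMap.finrank_le_finrank_of_injective (f :=
          LinearMap.lcomp k (R ⧸ 𝔪) (Module.jacobson R M).mkQ) fun a b hab => ?_
        exact LinearMap.ext fun x => by
          obtain ⟨x, rfl⟩ := (Module.jacobson R M).mkQ_surjective x
          exact LinearMap.congr_fun hab x
      · have hker : ∀ f : N →ₗ[R] R ⧸ 𝔪, Module.jacobson R N ≤ LinearMap.ker f := fun f => by
          refine (Module.le_comap_jacobson f).trans ?_
          rw [IsSemisimpleModule.jacobson_eq_bot]
          exact le_of_eq (Submodule.comap_bot f)
        refine LinearMap.finrank_le_finrank_of_injective (f :=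
          ({ toFun := fun f => (Module.jacobson R N).liftQ f (hker f)
             map_add' := fun f g => by ext; simp
             map_smul' := fun c f => by ext; simp } :
            (N →ₗ[R] R ⧸ 𝔪) →ₗ[k] (N ⧸ Module.jacobson R N →ₗ[R] R ⧸ 𝔪))) fun a b hab => ?_
        ext x
        exact LinearMap.congr_fun hab (Submodule.Quotient.mk x))
  obtain ⟨f, hf⟩ := Module.projective_lifting_property (Module.jacobson R M).mkQ
    (g ∘ₗ (Module.jacobson R N).mkQ) (Submodule.mkQ_surjective _)
  refine ⟨f, ?_⟩
  rw [← LinearMap.range_eq_top]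
  by_contra hne
  -- Nakayama: a maximal submodule containing the range also contains the radical of M, and range
  -- plus radical is everything.
  obtain ⟨c, hc, hle⟩ := (eq_top_or_exists_le_coatom (LinearMap.range f)).resolve_left hne
  apply hc.1
  rw [eq_top_iff]
  rintro m -
  obtain ⟨y, hy⟩ := hg ((Module.jacobson R M).mkQ m)
  obtain ⟨n, rfl⟩ := (Module.jacobson R N).mkQ_surjective y
  have h3 : (Module.jacobson R M).mkQ m = (Module.jacobson R M).mkQ (f n) := by
    rw [← hy]; exact (LinearMap.congr_fun hf n).symm
  have h4 : m - f n ∈ Module.jacobson R M := by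
    rwa [← sub_eq_zero, ← map_sub, Submodule.mkQ_apply, Submodule.Quotient.mk_eq_zero] at h3
  have h5 : m - f n ∈ c := (sInf_le (show c ∈ {m : Submodule R M | IsCoatom m} from hc)) h4
  simpa using c.add_mem h5 (hle ⟨n, rfl⟩)

/-- Among the simple modules there is one maximizing the ratio
`dim Hom(M, R ⧸ 𝔪) / dim (R ⧸ 𝔪)`. -/
theorem LinearMap.exists_isMaximal_finrank_hom_ratio [Module.Finite k R]
    (M : Type*) [AddCommGroup M] [Module k M]
    [Module R M] [IsScalarTower k R M] [Module.Finite k M] [Nontrivial M] :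
    ∃ 𝔪 : Ideal R, 𝔪.IsMaximal ∧ 0 < Module.finrank k (M →ₗ[R] R ⧸ 𝔪) ∧
      ∀ 𝔫 : Ideal R, 𝔫.IsMaximal →
        Module.finrank k (M →ₗ[R] R ⧸ 𝔫) * Module.finrank k (R ⧸ 𝔪) ≤
        Module.finrank k (M →ₗ[R] R ⧸ 𝔪) * Module.finrank k (R ⧸ 𝔫) := by
  have hRM : Module.Finite R M := Module.Finite.of_restrictScalars_finite k R M
  have hq : ∀ 𝔪 : Ideal R, Module.Finite k (R ⧸ 𝔪) :=
    fun 𝔪 => Submodule.finite_quotient_of_isScalarTower k 𝔪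
  have hh : ∀ 𝔪 : Ideal R, Module.Finite k (M →ₗ[R] R ⧸ 𝔪) :=
    fun 𝔪 => LinearMap.finite_of_isScalarTower (R := R) k M (R ⧸ 𝔪)
  obtain ⟨c, hc⟩ := IsCoatomic.exists_coatom (α := Submodule R M)
  have hcs : IsSimpleModule R (M ⧸ c) := isSimpleModule_iff_isCoatom.2 hc
  obtain ⟨𝔪₀, h𝔪₀, ⟨e⟩⟩ := isSimpleModule_iff_quot_maximal.1 hcs
  have h0 : 0 < Module.finrank k (M →ₗ[R] R ⧸ 𝔪₀) := by
    rw [Module.finrank_pos_iff_exists_ne_zero]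
    refine ⟨e.toLinearMap ∘ₗ c.mkQ, fun h => ?_⟩
    have := IsSimpleModule.nontrivial R (M ⧸ c)
    obtain ⟨x, hx⟩ := exists_ne (0 : M ⧸ c)
    obtain ⟨x, rfl⟩ := c.mkQ_surjective x
    exact hx (by simpa using LinearMap.congr_fun h x)
  let r : Ideal R → ℕ × ℕ := fun 𝔪 =>
    (Module.finrank k (M →ₗ[R] R ⧸ 𝔪), Module.finrank k (R ⧸ 𝔪))
  -- Both dimensions are bounded independently of the ideal, so only finitely many ratios occur and
  -- a maximum exists.
  have hfin : (r '' {𝔪 | 𝔪.IsMaximal}).Finite := by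
    refine ((Set.finite_Iic (Module.finrank k (M →ₗ[k] R))).prod
      (Set.finite_Iic (Module.finrank k R))).subset ?_
    rintro _ ⟨𝔪, -, rfl⟩
    have h1 : Module.finrank k (R ⧸ 𝔪) ≤ Module.finrank k R :=
      LinearMap.finrank_le_finrank_of_surjective (f := 𝔪.mkQ.restrictScalars k) 𝔪.mkQ_surjective
    refine ⟨?_, h1⟩
    refine (LinearMap.finrank_le_finrank_of_injective
      (f := LinearMap.restrictScalarsₗ k R M (R ⧸ 𝔪) k)
      (LinearMap.restrictScalars_injective k)).trans ?_
    rw [Module.finrank_linearMap, Module.finrank_linearMap]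
    exact Nat.mul_le_mul_left _ h1
  obtain ⟨_, ⟨𝔪, h𝔪, rfl⟩, hmax⟩ := hfin.exists_maximalFor
    (fun p : ℕ × ℕ => (p.1 : ℚ) / p.2) _ ⟨_, 𝔪₀, h𝔪₀, rfl⟩
  have hpos : ∀ 𝔫 : Ideal R, 𝔫.IsMaximal → (0 : ℚ) < Module.finrank k (R ⧸ 𝔫) := by
    intro 𝔫 h𝔫
    have : Nontrivial (R ⧸ 𝔫) := Submodule.Quotient.nontrivial_iff.2 h𝔫.ne_top
    exact_mod_cast Module.finrank_pos
  have hmax' : ∀ 𝔫 : Ideal R, 𝔫.IsMaximal →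
      (Module.finrank k (M →ₗ[R] R ⧸ 𝔫) : ℚ) / Module.finrank k (R ⧸ 𝔫) ≤
      Module.finrank k (M →ₗ[R] R ⧸ 𝔪) / Module.finrank k (R ⧸ 𝔪) := fun 𝔫 h𝔫 =>
    (le_total _ _).elim (fun h => h) (fun h => hmax ⟨𝔫, h𝔫, rfl⟩ h)
  have key : ∀ 𝔫 : Ideal R, 𝔫.IsMaximal →
        Module.finrank k (M →ₗ[R] R ⧸ 𝔫) * Module.finrank k (R ⧸ 𝔪) ≤
        Module.finrank k (M →ₗ[R] R ⧸ 𝔪) * Module.finrank k (R ⧸ 𝔫) := fun 𝔫 h𝔫 => by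
    have := hmax' 𝔫 h𝔫
    rw [div_le_div_iff₀ (hpos 𝔫 h𝔫) (hpos 𝔪 h𝔪)] at this
    exact_mod_cast this
  refine ⟨𝔪, h𝔪, ?_, key⟩
  -- Some simple quotient has a nonzero Hom space, so the maximal ratio is positive.
  refine Nat.pos_of_mul_pos_right (lt_of_lt_of_le ?_ (key 𝔪₀ h𝔪₀))
  exact Nat.mul_pos h0 (by exact_mod_cast hpos 𝔪 h𝔪)

end FiniteDimensional

/-! ### Comodule algebras, the modules V ⊗ H and Hom(H, V), and the core of a module. -/

/-- A vector space `X` viewed as a module over an algebra `R` through `θ : R → End X`. -/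
def RepModule {k R X : Type*} [Field k] [Ring R] [Algebra k R] [AddCommGroup X] [Module k X]
    (_ : R →ₐ[k] Module.End k X) : Type _ := X

namespace RepModule

variable {k R X : Type*} [Field k] [Ring R] [Algebra k R] [AddCommGroup X] [Module k X]
    (θ : R →ₐ[k] Module.End k X)

instance : AddCommGroup (RepModule θ) := inferInstanceAs (AddCommGroup X)
instance : Module k (RepModule θ) := inferInstanceAs (Module k X)
instance : Module R (RepModule θ) := Module.compHom X θ.toRingHom

variable {θ} in
theorem smul_def (x : R) (m : RepModule θ) : x • m = (θ x : X →ₗ[k] X) m := rfl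

instance : IsScalarTower k R (RepModule θ) where
  smul_assoc c x m := by
    rw [smul_def, map_smul]
    rfl

instance [Module.Finite k X] : Module.Finite k (RepModule θ) :=
  inferInstanceAs (Module.Finite k X)

end RepModule

/-- A right coaction of a bialgebra `H` on an algebra `R`, making `R` a right `H`-comodule
algebra. -/
structure Coaction (k H R : Type*) [Field k] [Ring H] [Bialgebra k H] [Ring R] [Algebra k R] where
  /-- The coaction `R → R ⊗ H`. -/
  map : R →ₐ[k] R ⊗[k] H
  coassoc : ∀ x, TensorProduct.assoc k R H H (map.toLinearMap.rTensor H (map x)) =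
    (Coalgebra.comul (R := k)).lTensor R (map x)
  counit : ∀ x, TensorProduct.contractSnd R (Coalgebra.counit (R := k)) (map x) = x

namespace Coaction

section Modules

variable {k H R : Type*} [Field k] [Ring H] [HopfAlgebra k H] [Ring R] [Algebra k R]
  (δ : Coaction k H R)
  (V : Type*) [AddCommGroup V] [Module k V] [Module R V] [IsScalarTower k R V]

/-- The action `(r ⊗ h) (v ⊗ l) = θ(r) v ⊗ h l` of `R ⊗ H` on `X ⊗ H` for an algebra map
`θ : R → End X`. -/
noncomputable def tensorRepOf {X : Type*} [AddCommGroup X] [Module k X]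
    (θ : R →ₐ[k] Module.End k X) : R ⊗[k] H →ₐ[k] Module.End k (X ⊗[k] H) :=
  (Module.endTensorEndAlgHom (R := k) (S := k) (A := k)).comp
    (Algebra.TensorProduct.map θ (Algebra.lmul k H))

theorem tensorRepOf_tmul {X : Type*} [AddCommGroup X] [Module k X]
    (θ : R →ₐ[k] Module.End k X) (r : R) (h : H) (v : X) (l : H) :
    tensorRepOf θ (r ⊗ₜ[k] h) (v ⊗ₜ l) = (θ r v) ⊗ₜ (h * l) := rfl

/-- The action `(r ⊗ h) (v ⊗ l) = r v ⊗ h l` of `R ⊗ H` on `V ⊗ H`. -/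
noncomputable def tensorRep : R ⊗[k] H →ₐ[k] Module.End k (V ⊗[k] H) :=
  tensorRepOf (Algebra.lsmul k k V)

theorem tensorRep_tmul (r : R) (h : H) (v : V) (l : H) :
    tensorRep V (r ⊗ₜ[k] h) (v ⊗ₜ l) = (r • v) ⊗ₜ (h * l) := rfl

/-- The action `(r ⊗ h) φ = (l ↦ r φ(S(h) l))` of `R ⊗ H` on `Hom(H, V)`. -/
noncomputable def homRep : R ⊗[k] H →ₐ[k] Module.End k (H →ₗ[k] V) :=
  Algebra.TensorProduct.lift
    (AlgHom.ofLinearMap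
      ({ toFun := fun r => LinearMap.compRight k (Algebra.lsmul k k V r)
         map_add' := fun r s => by ext; simp
         map_smul' := fun c r => by ext; simp } : R →ₗ[k] Module.End k (H →ₗ[k] V))
      (by ext; simp) (fun r s => by ext; simp))
    (AlgHom.ofLinearMap
      ({ toFun := fun h => LinearMap.lcomp k V (LinearMap.mulLeft k (HopfAlgebra.antipode k h))
         map_add' := fun r s => by ext; simp [add_mul]
         map_smul' := fun c r => by ext; simp } : H →ₗ[k] Module.End k (H →ₗ[k] V))
      (by ext; simp) (fun r s => by
        ext; simp [HopfAlgebra.antipode_mul_antidistrib]))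
    (fun r h => by ext; simp)

theorem homRep_tmul (r : R) (h : H) (φ : H →ₗ[k] V) (l : H) :
    homRep V (r ⊗ₜ[k] h) φ l = r • φ (HopfAlgebra.antipode k h * l) := rfl

/-- The `R`-module `V ⊗ H` with `x (v ⊗ h) = x₀ v ⊗ x₁ h`. -/
abbrev Tensor : Type _ := RepModule ((tensorRep (k := k) (H := H) (R := R) V).comp δ.map)

/-- The `R`-module `Hom(H, V)` with `(x φ)(h) = x₀ φ(S(x₁) h)`. -/
abbrev HomModule : Type _ := RepModule ((homRep (k := k) (H := H) (R := R) V).comp δ.map)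

/-- The coefficients `(id ⊗ f) ρ(x)` of the coaction. -/
noncomputable def coeff (f : Module.Dual k H) : R →ₗ[k] R :=
  TensorProduct.contractSnd R f ∘ₗ δ.map.toLinearMap

theorem coeff_counit (x : R) : δ.coeff (Coalgebra.counit (R := k)) x = x := δ.counit x

/-- By coassociativity both sides are x₀ g(x₁) f(x₂). In particular coefficients of coefficients are
coefficients, which yields stability of cores and of subalgebras generated by coefficients. -/
theorem coeff_coeff (f g : Module.Dual k H) (x : R) :
    δ.coeff g (δ.coeff f x) = δ.coeff
      (LinearMap.mul' k k ∘ₗ TensorProduct.map g f ∘ₗ Coalgebra.comul (R := k)) x := by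
  have h1 : ∀ t : R ⊗[k] H, δ.coeff g (TensorProduct.contractSnd R f t) =
      TensorProduct.contractSnd R (LinearMap.mul' k k ∘ₗ TensorProduct.map g f)
        (TensorProduct.assoc k R H H (δ.map.toLinearMap.rTensor H t)) := by
    intro t
    induction t with
    | zero => simp
    | add x y hx hy => simp only [map_add, hx, hy]
    | tmul r h =>
      rw [TensorProduct.contractSnd_tmul, map_smul, LinearMap.rTensor_tmul, coeff,
        LinearMap.comp_apply]
      generalize δ.map.toLinearMap r = s
      induction s with
      | zero => simp
      | add x y hx hy => simp only [map_add, smul_add, TensorProduct.add_tmul, hx, hy]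
      | tmul a b => simp [smul_smul, mul_comm]
  have h2 : ∀ t : R ⊗[k] H, TensorProduct.contractSnd R (LinearMap.mul' k k ∘ₗ
      TensorProduct.map g f) ((Coalgebra.comul (R := k)).lTensor R t) =
      TensorProduct.contractSnd R (LinearMap.mul' k k ∘ₗ
      TensorProduct.map g f ∘ₗ Coalgebra.comul (R := k)) t := by
    intro t
    induction t with
    | zero => simp
    | add x y hx hy => simp only [map_add, hx, hy]
    | tmul r h => simp
  rw [show δ.coeff f x = TensorProduct.contractSnd R f (δ.map x) from rfl, h1]
  exact (congrArg _ (δ.coassoc x)).trans (h2 _)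

/-- All coefficients of `x` annihilate `V`. -/
def IsCoreElement (x : R) : Prop := ∀ (f : Module.Dual k H) (v : V), δ.coeff f x • v = 0

variable {V} {δ}

theorem IsCoreElement.coeff {x : R} (hx : δ.IsCoreElement V x) (f : Module.Dual k H) :
    δ.IsCoreElement V (δ.coeff f x) := fun g v => by rw [coeff_coeff]; exact hx _ v

/-- The contractions of this tensor are the operators by which the coefficients of x act on V. The
actions on V ⊗ H and Hom(H, V) both factor through End V ⊗ H, so this one vanishing kills both
modules. -/
theorem IsCoreElement.rTensor_eq_zero {x : R} (hx : δ.IsCoreElement V x) :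
    (Algebra.lsmul k k V).toLinearMap.rTensor H (δ.map x) = 0 := by
  apply TensorProduct.eq_zero_of_contractSnd
  intro f
  have h1 : ∀ t : R ⊗[k] H, TensorProduct.contractSnd (Module.End k V) f
      ((Algebra.lsmul k k V).toLinearMap.rTensor H t) =
      Algebra.lsmul k k V (TensorProduct.contractSnd R f t) := by
    intro t
    induction t with
    | zero => simp
    | add x y hx hy => simp only [map_add, hx, hy]
    | tmul r h => simp
  rw [h1]
  ext v
  exact hx f v

theorem IsCoreElement.smul_tensor {x : R} (hx : δ.IsCoreElement V x) (m : δ.Tensor V) :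
    x • m = 0 := by
  have h1 : ∀ t : R ⊗[k] H, tensorRep V t =
      Module.endTensorEndAlgHom (R := k) (S := k) (A := k) (M := V) (N := H)
        ((Algebra.lmul k H).toLinearMap.lTensor _
          ((Algebra.lsmul k k V).toLinearMap.rTensor H t)) := by
    intro t
    induction t with
    | zero => simp
    | add x y hx hy => simp only [map_add, hx, hy]
    | tmul r h => rfl
  rw [RepModule.smul_def, AlgHom.comp_apply, h1, hx.rTensor_eq_zero, map_zero, map_zero]
  rfl

theorem IsCoreElement.smul_hom {x : R} (hx : δ.IsCoreElement V x) (m : δ.HomModule V) :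
    x • m = 0 := by
  let B : Module.End k V ⊗[k] H →ₗ[k] Module.End k (H →ₗ[k] V) :=
    TensorProduct.lift (LinearMap.mk₂ k
      (fun T h => LinearMap.compRight k T ∘ₗ
        LinearMap.lcomp k V (LinearMap.mulLeft k (HopfAlgebra.antipode k h)))
      (fun _ _ _ => by ext; simp) (fun _ _ _ => by ext; simp)
      (fun _ _ _ => by ext; simp [add_mul]) (fun _ _ _ => by ext; simp))
  have h1 : ∀ t : R ⊗[k] H, homRep V t = B ((Algebra.lsmul k k V).toLinearMap.rTensor H t) := by
    intro t
    induction t with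
    | zero => simp
    | add x y hx hy => simp only [map_add, hx, hy]
    | tmul r h => ext; simp [homRep_tmul, B]
  rw [RepModule.smul_def, AlgHom.comp_apply, h1, hx.rTensor_eq_zero, map_zero]
  rfl

/-- Contracting x(v ⊗ 1) = x₀v ⊗ x₁ against f recovers the action of each coefficient. -/
theorem isCoreElement_of_smul_tensor {x : R} (hx : ∀ m : δ.Tensor V, x • m = 0) :
    δ.IsCoreElement V x := by
  intro f v
  have h1 : ∀ t : R ⊗[k] H, TensorProduct.contractSnd V f (tensorRep V t (v ⊗ₜ 1)) =
      TensorProduct.contractSnd R f t • v := by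
    intro t
    induction t with
    | zero => simp
    | add x y hx hy => simp only [map_add, LinearMap.add_apply, hx, hy, add_smul]
    | tmul r h => simp [tensorRep_tmul]
  have h2 := h1 (δ.map x)
  rw [show tensorRep V (δ.map x) (v ⊗ₜ 1) = 0 from hx (v ⊗ₜ[k] (1 : H) : V ⊗[k] H),
    map_zero] at h2
  exact h2.symm

/-- Take a linear left inverse g of S and test x on φ = f(g(·))v: then (xφ)(1) = x₀φ(S(x₁)) is the
f-coefficient of x applied to v. -/
theorem isCoreElement_of_smul_hom
    (hS : Function.Injective (HopfAlgebra.antipode k : H →ₗ[k] H)) {x : R}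
    (hx : ∀ m : δ.HomModule V, x • m = 0) : δ.IsCoreElement V x := by
  intro f v
  obtain ⟨g, hg⟩ := LinearMap.exists_leftInverse_of_injective _ (LinearMap.ker_eq_bot.2 hS)
  let φ : H →ₗ[k] V := LinearMap.toSpanSingleton k V v ∘ₗ f ∘ₗ g
  have h1 : ∀ t : R ⊗[k] H, homRep V t φ 1 = TensorProduct.contractSnd R f t • v := by
    intro t
    induction t with
    | zero => simp
    | add x y hx hy => simp only [map_add, LinearMap.add_apply, hx, hy, add_smul]
    | tmul r h =>
      have : g (HopfAlgebra.antipode k h) = h := LinearMap.congr_fun hg h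
      simp only [homRep_tmul, mul_one, φ, LinearMap.comp_apply, this,
        TensorProduct.contractSnd_tmul, LinearMap.toSpanSingleton_apply, smul_assoc]
      rw [smul_comm]
  have h2 := h1 (δ.map x)
  rw [show homRep V (δ.map x) φ = 0 from hx (φ : H →ₗ[k] V), LinearMap.zero_apply] at h2
  exact h2.symm

end Modules

/-! ### Hopf modules and the adjunction between V ⊗ H and Hom(H, W). -/

section Hopf

variable {k H R : Type*} [Field k] [Ring H] [HopfAlgebra k H] [Ring R] [Algebra k R]
  {δ : Coaction k H R}
  {V : Type*} [AddCommGroup V] [Module k V] [Module R V] [IsScalarTower k R V]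
  {M : Type*} [AddCommGroup M] [Module k M] [Module R M] [IsScalarTower k R M]

/-- The map `m ⊗ l ↦ (h ↦ G(S(l) h)(m))`. -/
noncomputable def homTwist (G : H →ₗ[k] (M →ₗ[R] V)) : M ⊗[k] H →ₗ[k] (H →ₗ[k] V) :=
  TensorProduct.lift (LinearMap.mk₂ k
    (fun m l => LinearMap.applyₗ (R := k) m ∘ₗ LinearMap.restrictScalarsₗ k R M V k ∘ₗ G ∘ₗ
      LinearMap.mulLeft k (HopfAlgebra.antipode k l))
    (fun _ _ _ => by ext; simp) (fun _ _ _ => by ext; simp)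
    (fun _ _ _ => by ext; simp [add_mul]) (fun _ _ _ => by ext; simp))

theorem homTwist_tmul (G : H →ₗ[k] (M →ₗ[R] V)) (m : M) (l h : H) :
    homTwist G (m ⊗ₜ l) h = G (HopfAlgebra.antipode k l * h) m := by
  simp [homTwist]

theorem homTwist_tensorRep (G : H →ₗ[k] (M →ₗ[R] V)) (t : R ⊗[k] H) (s : M ⊗[k] H) :
    homTwist G (tensorRep M t s) = homRep V t (homTwist G s) := by
  induction t with
  | zero => simp
  | add x y hx hy => simp only [map_add, LinearMap.add_apply, hx, hy]
  | tmul r h =>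
  induction s with
  | zero => simp
  | add x y hx hy => simp only [map_add, hx, hy]
  | tmul m l =>
    ext a
    rw [tensorRep_tmul, homTwist_tmul, homRep_tmul, homTwist_tmul,
      HopfAlgebra.antipode_mul_antidistrib, map_smul, mul_assoc]

variable (δ V) in
/-- For a Hopf module `M` there are many `R`-linear maps from `M` to `Hom(H, V)`. -/
theorem finrank_hom_le_finrank_hom_homModule [Module.Finite k H] [Module.Finite k V]
    [Module.Finite k M] (d : M →ₗ[k] M ⊗[k] H)
    (hd : ∀ (x : R) (m : M), d (x • m) = tensorRep M (δ.map x) (d m))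
    (hco : ∀ m, TensorProduct.assoc k M H H (d.rTensor H (d m)) =
      (Coalgebra.comul (R := k)).lTensor M (d m))
    (hcu : ∀ m, TensorProduct.contractSnd M (Coalgebra.counit (R := k)) (d m) = m) :
    Module.finrank k H * Module.finrank k (M →ₗ[R] V) ≤
      Module.finrank k (M →ₗ[R] δ.HomModule V) := by
  have := LinearMap.finite_of_isScalarTower (R := R) k M V
  have := LinearMap.finite_of_isScalarTower (R := R) k M (δ.HomModule V)
  rw [← Module.finrank_linearMap]
  -- Φ(G)(m) = (h ↦ G(S(m₁)h)(m₀)). Linearity over R comes from compatibility of d with the action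
  -- and antimultiplicativity of S.
  let Φ : (H →ₗ[k] (M →ₗ[R] V)) →ₗ[k] (M →ₗ[R] δ.HomModule V) :=
    { toFun := fun G =>
        { toFun := fun m => (homTwist G (d m) : H →ₗ[k] V)
          map_add' := fun m n => by rw [map_add, map_add]; rfl
          map_smul' := fun x m => by
            rw [hd, homTwist_tensorRep]; rfl }
      map_add' := fun G G' => by
        ext m : 1
        change homTwist (G + G') (d m) = homTwist G (d m) + homTwist G' (d m)
        generalize d m = t
        induction t with
        | zero => simp
        | add x y hx hy => rw [map_add, map_add, map_add, hx, hy]; abel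
        | tmul m l => ext; simp [homTwist_tmul]
      map_smul' := fun c G => by
        ext m : 1
        change homTwist (c • G) (d m) = c • homTwist G (d m)
        generalize d m = t
        induction t with
        | zero => simp
        | add x y hx hy => rw [map_add, map_add, hx, hy, smul_add]
        | tmul m l => ext; simp [homTwist_tmul] }
  refine LinearMap.finrank_le_finrank_of_injective (f := Φ) ?_
  rw [injective_iff_map_eq_zero]
  intro G hG
  have hG' : ∀ m, homTwist G (d m) = 0 := fun m => LinearMap.congr_fun hG m
  ext h m
  -- Injectivity of Φ: evaluating Φ(G)(m₀) at m₁h gives G(S(m₁)m₂h)(m₀) = G(h)(m), so G is recovered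
  -- from Φ(G).
  let P : M ⊗[k] (H ⊗[k] H) →ₗ[k] V :=
    TensorProduct.lift (LinearMap.mk₂ k
      (fun m z => G (LinearMap.mul' k H ((HopfAlgebra.antipode k).rTensor H z) * h) m)
      (fun _ _ _ => by simp) (fun _ _ _ => by simp)
      (fun _ _ _ => by simp [add_mul]) (fun _ _ _ => by simp))
  have h1 : ∀ t : M ⊗[k] H, P (TensorProduct.assoc k M H H (d.rTensor H t)) = 0 := by
    intro t
    induction t with
    | zero => simp
    | add x y hx hy => simp only [map_add, hx, hy, add_zero]
    | tmul m l =>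
      rw [LinearMap.rTensor_tmul]
      have h2 : ∀ s : M ⊗[k] H,
          P (TensorProduct.assoc k M H H (s ⊗ₜ l)) = homTwist G s (l * h) := by
        intro s
        induction s with
        | zero => simp
        | add x y hx hy => simp only [map_add, TensorProduct.add_tmul, hx, hy,
            LinearMap.add_apply]
        | tmul a b => simp [homTwist_tmul, P, mul_assoc]
      rw [h2, hG', LinearMap.zero_apply]
  have h3 : ∀ t : M ⊗[k] H, P ((Coalgebra.comul (R := k)).lTensor M t) =
      G h (TensorProduct.contractSnd M (Coalgebra.counit (R := k)) t) := by
    intro t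
    induction t with
    | zero => simp
    | add x y hx hy => simp only [map_add, hx, hy]
    | tmul m l =>
      simp only [LinearMap.lTensor_tmul, P, TensorProduct.lift.tmul, LinearMap.mk₂_apply,
        HopfAlgebra.mul_antipode_rTensor_comul_apply, TensorProduct.contractSnd_tmul]
      rw [Algebra.algebraMap_eq_smul_one, smul_mul_assoc, one_mul, map_smul, LinearMap.smul_apply,
        ← algebraMap_smul R _ m, map_smul, algebraMap_smul]
  rw [LinearMap.zero_apply, LinearMap.zero_apply, ← hcu m, ← h3, ← hco, h1]

variable (V) in
/-- The coaction `id ⊗ Δ` on `V ⊗ H`. -/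
noncomputable def tensorCoaction : V ⊗[k] H →ₗ[k] (V ⊗[k] H) ⊗[k] H :=
  (TensorProduct.assoc k V H H).symm.toLinearMap ∘ₗ (Coalgebra.comul (R := k)).lTensor V

theorem tensorCoaction_contract (m : V ⊗[k] H) :
    TensorProduct.contractSnd (V ⊗[k] H) (Coalgebra.counit (R := k)) (tensorCoaction V m) = m := by
  induction m with
  | zero => simp
  | add x y hx hy => simp only [map_add, hx, hy]
  | tmul v h =>
    have h1 : ∀ s : H ⊗[k] H, TensorProduct.contractSnd (V ⊗[k] H) (Coalgebra.counit (R := k))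
        ((TensorProduct.assoc k V H H).symm (v ⊗ₜ s)) =
        v ⊗ₜ TensorProduct.rid k H ((Coalgebra.counit (R := k)).lTensor H s) := by
      intro s
      induction s with
      | zero => simp
      | add x y hx hy => simp only [map_add, TensorProduct.tmul_add, hx, hy]
      | tmul a b => simp
    rw [tensorCoaction, LinearMap.comp_apply, LinearMap.lTensor_tmul, LinearEquiv.coe_coe, h1,
      Coalgebra.lTensor_counit_comul]
    simp

theorem tensorCoaction_coassoc (m : V ⊗[k] H) :
    TensorProduct.assoc k (V ⊗[k] H) H H ((tensorCoaction V).rTensor H (tensorCoaction V m)) =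
      (Coalgebra.comul (R := k)).lTensor (V ⊗[k] H) (tensorCoaction V m) := by
  induction m with
  | zero => simp
  | add x y hx hy => simp only [map_add, hx, hy]
  | tmul v h =>
    rw [tensorCoaction, LinearMap.comp_apply, LinearMap.lTensor_tmul, LinearEquiv.coe_coe]
    have h1 : ∀ s : H ⊗[k] H, TensorProduct.assoc k (V ⊗[k] H) H H
        (((TensorProduct.assoc k V H H).symm.toLinearMap ∘ₗ
          (Coalgebra.comul (R := k)).lTensor V).rTensor H
          ((TensorProduct.assoc k V H H).symm (v ⊗ₜ s))) =
        (TensorProduct.assoc k V H (H ⊗[k] H)).symm (v ⊗ₜ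
          (TensorProduct.assoc k H H H ((Coalgebra.comul (R := k)).rTensor H s))) := by
      intro s
      induction s with
      | zero => simp
      | add x y hx hy => simp only [map_add, TensorProduct.tmul_add, hx, hy]
      | tmul a b =>
        simp only [TensorProduct.assoc_symm_tmul, LinearMap.rTensor_tmul, LinearMap.comp_apply,
          LinearMap.lTensor_tmul, LinearEquiv.coe_coe]
        generalize Coalgebra.comul (R := k) a = z
        induction z with
        | zero => simp
        | add x y hx hy => simp only [map_add, TensorProduct.tmul_add, TensorProduct.add_tmul,
            hx, hy]
        | tmul c d => simp
    have h2 : ∀ s : H ⊗[k] H, (Coalgebra.comul (R := k)).lTensor (V ⊗[k] H)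
        ((TensorProduct.assoc k V H H).symm (v ⊗ₜ s)) =
        (TensorProduct.assoc k V H (H ⊗[k] H)).symm (v ⊗ₜ
          ((Coalgebra.comul (R := k)).lTensor H s)) := by
      intro s
      induction s with
      | zero => simp
      | add x y hx hy => simp only [map_add, TensorProduct.tmul_add, hx, hy]
      | tmul a b => simp
    rw [h1, h2, Coalgebra.coassoc_apply]

/-- This is the Hopf module compatibility of V ⊗ H. It combines multiplicativity of Δ with
coassociativity of the coaction on R. -/
theorem tensorCoaction_smul (x : R) (m : δ.Tensor V) :
    (tensorCoaction V (x • m : δ.Tensor V) : (V ⊗[k] H) ⊗[k] H) =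
      tensorRep (δ.Tensor V) (δ.map x) (tensorCoaction V m : (V ⊗[k] H) ⊗[k] H) := by
  have h1 : ∀ (t : R ⊗[k] H) (m : V ⊗[k] H), tensorCoaction V (tensorRep V t m) =
      tensorRepOf (tensorRep (k := k) (H := H) (R := R) V)
        ((TensorProduct.assoc k R H H).symm ((Coalgebra.comul (R := k)).lTensor R t))
        (tensorCoaction V m) := by
    intro t m
    induction t with
    | zero => simp
    | add x y hx hy => simp only [map_add, LinearMap.add_apply, hx, hy]
    | tmul r h =>
    induction m with
    | zero => simp
    | add x y hx hy => simp only [map_add, hx, hy]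
    | tmul v l =>
      rw [tensorRep_tmul, tensorCoaction, LinearMap.comp_apply, LinearMap.comp_apply,
        LinearMap.lTensor_tmul, LinearMap.lTensor_tmul, LinearMap.lTensor_tmul,
        Bialgebra.comul_mul]
      generalize Coalgebra.comul (R := k) h = s
      generalize Coalgebra.comul (R := k) l = z
      induction s with
      | zero => simp
      | add x y hx hy => simp only [map_add, LinearMap.add_apply, add_mul,
          TensorProduct.tmul_add, hx, hy]
      | tmul a b =>
      induction z with
      | zero => simp
      | add x y hx hy => simp only [map_add, mul_add, TensorProduct.tmul_add, hx, hy]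
      | tmul c d =>
        rw [Algebra.TensorProduct.tmul_mul_tmul, LinearEquiv.coe_coe,
          TensorProduct.assoc_symm_tmul, TensorProduct.assoc_symm_tmul,
          TensorProduct.assoc_symm_tmul, tensorRepOf_tmul, tensorRep_tmul]
  have h2 : ∀ (t : R ⊗[k] H) (s : (V ⊗[k] H) ⊗[k] H),
      tensorRepOf (tensorRep (k := k) (H := H) (R := R) V) (δ.map.toLinearMap.rTensor H t) s =
      tensorRepOf ((tensorRep (k := k) (H := H) (R := R) V).comp δ.map) t s := by
    intro t s
    induction t with
    | zero => simp
    | add x y hx hy => simp only [map_add, LinearMap.add_apply, hx, hy]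
    | tmul r h =>
    induction s with
    | zero => simp
    | add x y hx hy => simp only [map_add, hx, hy]
    | tmul m l => rfl
  have h3 := h1 (δ.map x) m
  have h4 := congrArg (TensorProduct.assoc k R H H).symm (δ.coassoc x)
  rw [LinearEquiv.symm_apply_apply] at h4
  rw [← h4, h2] at h3
  exact h3

/-- A nonzero `R`-linear map `V ⊗ H → W` with `V` simple embeds `V` into `Hom(H, W)`. -/
theorem exists_ne_zero_hom_homModule {W : Type*} [AddCommGroup W] [Module k W] [Module R W]
    [IsScalarTower k R W] (g : δ.Tensor V →ₗ[R] W) (hg : g ≠ 0) :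
    ∃ γ : V →ₗ[R] δ.HomModule W, γ ≠ 0 := by
  let g' : V ⊗[k] H →ₗ[k] W := g.restrictScalars k
  have hg' : ∀ (t : R ⊗[k] H → V ⊗[k] H → V ⊗[k] H) (x : R) (m : V ⊗[k] H),
      g' (tensorRep V (δ.map x) m) = x • g' m := fun _ x m => g.map_smul x m
  let γ : V →ₗ[k] (H →ₗ[k] W) := TensorProduct.curry g'
  refine ⟨{ toFun := fun v => (γ v : H →ₗ[k] W)
            map_add' := fun v v' => map_add γ v v'
            map_smul' := fun x v => ?_ }, fun h0 => hg ?_⟩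
  · change γ (x • v) = homRep W (δ.map x) (γ v)
    ext h
    -- T sends r ⊗ a ⊗ b to rv ⊗ aS(b)h. Linearity of the curried map is then x₀ g(v ⊗ S(x₁)h) =
    -- g(x₀v ⊗ x₁S(x₂)h) = g(xv ⊗ h).
    let T : R ⊗[k] (H ⊗[k] H) →ₗ[k] V ⊗[k] H :=
      TensorProduct.map (LinearMap.toSpanSingleton R V v |>.restrictScalars k)
        (LinearMap.mulRight k h ∘ₗ LinearMap.mul' k H ∘ₗ (HopfAlgebra.antipode k).lTensor H)
    have h1 : ∀ t : R ⊗[k] H, homRep W t (γ v) h =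
        g' (T (TensorProduct.assoc k R H H (δ.map.toLinearMap.rTensor H t))) := by
      intro t
      induction t with
      | zero => simp
      | add x y hx hy => simp only [map_add, LinearMap.add_apply, hx, hy]
      | tmul r l =>
        rw [homRep_tmul, TensorProduct.curry_apply, ← hg' (fun _ m => m), LinearMap.rTensor_tmul]
        congr 1
        change tensorRep V (δ.map r) _ = T (TensorProduct.assoc k R H H (δ.map r ⊗ₜ l))
        generalize δ.map r = s
        induction s with
        | zero => simp
        | add x y hx hy => simp only [map_add, LinearMap.add_apply, TensorProduct.add_tmul,
            hx, hy]
        | tmul a b => simp [T, tensorRep_tmul, mul_assoc]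
    have h2 : ∀ t : R ⊗[k] H, T ((Coalgebra.comul (R := k)).lTensor R t) =
        (TensorProduct.contractSnd R (Coalgebra.counit (R := k)) t • v) ⊗ₜ h := by
      intro t
      induction t with
      | zero => simp
      | add x y hx hy => simp only [map_add, hx, hy, add_smul, TensorProduct.add_tmul]
      | tmul r l =>
        simp [T, Algebra.algebraMap_eq_smul_one, TensorProduct.smul_tmul']
    rw [h1]
    have h3 := δ.coassoc x
    rw [h3, h2, δ.counit, TensorProduct.curry_apply]
  · have h1 : g' = 0 := by
      apply TensorProduct.ext'
      intro v h
      exact LinearMap.congr_fun (show γ v = 0 from LinearMap.congr_fun h0 v) h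
    ext m
    exact LinearMap.congr_fun h1 m

end Hopf

end Coaction

/-! ### Freeness over the quotient by a core, and stability of the radical in finite dimension. -/

theorem LinearMap.exists_comp_eq_of_ker_le {R M N P : Type*} [Ring R] [AddCommGroup M]
    [AddCommGroup N] [AddCommGroup P] [Module R M] [Module R N] [Module R P]
    {π : M →ₗ[R] N} (hπ : Function.Surjective π) (f : M →ₗ[R] P)
    (h : LinearMap.ker π ≤ LinearMap.ker f) : ∃ g : N →ₗ[R] P, g ∘ₗ π = f := by
  refine ⟨(LinearMap.ker π).liftQ f h ∘ₗ (π.quotKerEquivOfSurjective hπ).symm.toLinearMap, ?_⟩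
  ext x
  have : (π.quotKerEquivOfSurjective hπ).symm (π x) = Submodule.Quotient.mk x := by
    rw [LinearEquiv.symm_apply_eq]; rfl
  simp [this]

theorem LinearMap.finrank_hom_pi {k R : Type*} [Field k] [Ring R] [Algebra k R] (n : ℕ)
    (M T : Type*) [AddCommGroup M] [Module k M] [Module R M] [IsScalarTower k R M]
    [AddCommGroup T] [Module k T] [Module R T] [IsScalarTower k R T]
    [Module.Finite k M] [Module.Finite k T] :
    Module.finrank k ((Fin n → M) →ₗ[R] T) = n * Module.finrank k (M →ₗ[R] T) := by
  have := LinearMap.finite_of_isScalarTower (R := R) k M T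
  rw [← (LinearMap.lsum R (fun _ : Fin n => M) k).finrank_eq, Module.finrank_pi_fintype]
  simp

theorem LinearMap.finrank_hom_pi_ring {k R : Type*} [Field k] [Ring R] [Algebra k R] (n : ℕ)
    (T : Type*) [AddCommGroup T] [Module k T] [Module R T] [IsScalarTower k R T]
    [Module.Finite k R] [Module.Finite k T] :
    Module.finrank k ((Fin n → R) →ₗ[R] T) = n * Module.finrank k T := by
  rw [LinearMap.finrank_hom_pi, (LinearMap.ringLmapEquivSelf R k T).finrank_eq]

namespace Coaction

variable {k H R : Type*} [Field k] [Ring H] [HopfAlgebra k H] [Ring R] [Algebra k R]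
  {δ : Coaction k H R}
  {V : Type*} [AddCommGroup V] [Module k V] [Module R V] [IsScalarTower k R V]

/-- By adjunction V embeds into Hom(H, W), which is killed by the core of W together with all
coefficients of its elements. -/
theorem IsCoreElement.of_hom_tensor [IsSimpleModule R V] {W : Type*} [AddCommGroup W]
    [Module k W] [Module R W] [IsScalarTower k R W] {g : δ.Tensor V →ₗ[R] W} (hg : g ≠ 0) {x : R}
    (hx : δ.IsCoreElement W x) : δ.IsCoreElement V x := by
  obtain ⟨γ, hγ⟩ := exists_ne_zero_hom_homModule g hg
  intro f v
  apply LinearMap.injective_of_ne_zero hγ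
  rw [map_smul, map_zero, (hx.coeff f).smul_hom]

variable (δ V) in
/-- A power of `V ⊗ H` is free over the quotient of `R` by the core of the simple module `V`. -/
theorem exists_surjective_pi_tensor [Module.Finite k R] [Module.Finite k H] [Module.Finite k V]
    [IsSimpleModule R V] (hS : Function.Injective (HopfAlgebra.antipode k : H →ₗ[k] H)) :
    ∃ (a b : ℕ) (π : (Fin a → R) →ₗ[R] (Fin b → δ.Tensor V)), Function.Surjective π ∧
      0 < a ∧ 0 < b ∧ ∀ x, π x = 0 → ∀ i, δ.IsCoreElement V (x i) := by
  have hVn : Nontrivial V := IsSimpleModule.nontrivial R V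
  have hM : Nontrivial (δ.Tensor V) := by
    obtain ⟨v, hv⟩ := exists_ne (0 : V)
    refine ⟨⟨(v ⊗ₜ[k] (1 : H) : V ⊗[k] H), (0 : V ⊗[k] H), fun h => hv ?_⟩⟩
    have := congrArg (TensorProduct.contractSnd V (Coalgebra.counit (R := k) (A := H))) h
    simpa using this
  obtain ⟨𝔪, h𝔪, ha, hmax⟩ :=
    LinearMap.exists_isMaximal_finrank_hom_ratio k (R := R) (δ.Tensor V)
  have hW : IsSimpleModule R (R ⧸ 𝔪) := isSimpleModule_iff_isCoatom.2 h𝔪.out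
  have hWf : ∀ 𝔫 : Ideal R, Module.Finite k (R ⧸ 𝔫) :=
    fun 𝔫 => Submodule.finite_quotient_of_isScalarTower k 𝔫
  have hb : 0 < Module.finrank k (R ⧸ 𝔪) := by
    have := IsSimpleModule.nontrivial R (R ⧸ 𝔪)
    exact Module.finrank_pos
  set a := Module.finrank k (δ.Tensor V →ₗ[R] R ⧸ 𝔪)
  set b := Module.finrank k (R ⧸ 𝔪)
  -- Maximality of a/b says exactly that R^a has at least as many maps to each simple module as (V ⊗
  -- H)^b.
  obtain ⟨π, hπ⟩ := LinearMap.exists_surjective_of_projective (R := R) k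
    (M := Fin b → δ.Tensor V) (N := Fin a → R) (fun 𝔫 h𝔫 => by
      have h1 := hmax 𝔫 h𝔫
      rw [LinearMap.finrank_hom_pi, LinearMap.finrank_hom_pi_ring, mul_comm b]
      exact h1)
  refine ⟨a, b, π, hπ, ha, hb, fun x hx i => ?_⟩
  have hg : ∃ g : δ.Tensor V →ₗ[R] R ⧸ 𝔪, g ≠ 0 := by
    have := LinearMap.finite_of_isScalarTower (R := R) k (δ.Tensor V) (R ⧸ 𝔪)
    exact Module.finrank_pos_iff_exists_ne_zero.1 ha
  obtain ⟨g, hg⟩ := hg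
  -- Since V ⊗ H maps nontrivially to W = R/𝔪, it is enough that the coordinates of ker π kill
  -- Hom(H, W).
  refine IsCoreElement.of_hom_tensor hg (isCoreElement_of_smul_hom hS fun y => ?_)
  have hYf : Module.Finite k (δ.HomModule (R ⧸ 𝔪)) :=
    inferInstanceAs (Module.Finite k (H →ₗ[k] (R ⧸ 𝔪)))
  have f1 := LinearMap.finite_of_isScalarTower (R := R) k
    (Fin b → δ.Tensor V) (δ.HomModule (R ⧸ 𝔪))
  have f2 := LinearMap.finite_of_isScalarTower (R := R) k
    (Fin a → R) (δ.HomModule (R ⧸ 𝔪))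
  let P := LinearMap.lcomp k (δ.HomModule (R ⧸ 𝔪)) π
  have hP : Function.Injective P := fun f f' hff => LinearMap.ext fun z => by
    obtain ⟨z, rfl⟩ := hπ z
    exact LinearMap.congr_fun hff z
  have hY : Module.finrank k (δ.HomModule (R ⧸ 𝔪)) = Module.finrank k H * b :=
    Module.finrank_linearMap k k H (R ⧸ 𝔪)
  have hge := finrank_hom_le_finrank_hom_homModule δ (R ⧸ 𝔪) (M := δ.Tensor V)
    (tensorCoaction V) (fun x m => tensorCoaction_smul x m) (tensorCoaction_coassoc (V := V))
    (tensorCoaction_contract (V := V))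
  -- Composition with π gives one inequality. The Hopf module bound gives the other, since both
  -- sides compare with a · b · dim H.
  have hfe : Module.finrank k ((Fin b → δ.Tensor V) →ₗ[R] δ.HomModule (R ⧸ 𝔪)) =
      Module.finrank k ((Fin a → R) →ₗ[R] δ.HomModule (R ⧸ 𝔪)) := by
    refine le_antisymm (LinearMap.finrank_le_finrank_of_injective hP) ?_
    rw [LinearMap.finrank_hom_pi_ring, LinearMap.finrank_hom_pi, hY, mul_comm _ b, mul_left_comm,
      mul_comm a]
    exact Nat.mul_le_mul_left b hge
  -- Equal dimensions make composition with π surjective, so z ↦ zᵢy factors through π and vanishes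
  -- on its kernel.
  obtain ⟨f, hf⟩ := (LinearMap.injective_iff_surjective_of_finrank_eq_finrank hfe).1 hP
    (LinearMap.toSpanSingleton R _ y ∘ₗ LinearMap.proj i)
  have := LinearMap.congr_fun hf x
  simp only [P, LinearMap.lcomp_apply, hx, map_zero, LinearMap.comp_apply, LinearMap.proj_apply,
    LinearMap.toSpanSingleton_apply] at this
  exact this.symm

/-- A map out of R^a is a combination of its values on the standard basis, with the coordinates as
coefficients. Hence maps to modules killed by the core of V factor through π. -/
theorem smul_eq_zero_of_pi {Z : Type*} [AddCommGroup Z] [Module R Z]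
    (hZ : ∀ x, δ.IsCoreElement V x → ∀ z : Z, x • z = 0) {a b : ℕ}
    {π : (Fin a → R) →ₗ[R] (Fin b → δ.Tensor V)}
    (hk : ∀ x, π x = 0 → ∀ i, δ.IsCoreElement V (x i)) (f : (Fin a → R) →ₗ[R] Z) :
    LinearMap.ker π ≤ LinearMap.ker f := by
  intro x hx
  rw [LinearMap.mem_ker] at hx ⊢
  rw [LinearMap.pi_apply_eq_sum_univ f x]
  exact Finset.sum_eq_zero fun i _ => hZ _ (hk x hx i) _

/-- Every simple module that is annihilated by the core of `V` has the same core as `V`. -/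
theorem IsCoreElement.of_simple [Module.Finite k R] [Module.Finite k H] [Module.Finite k V]
    [IsSimpleModule R V] (hS : Function.Injective (HopfAlgebra.antipode k : H →ₗ[k] H))
    {W : Type*} [AddCommGroup W] [Module k W] [Module R W] [IsScalarTower k R W]
    [IsSimpleModule R W] (hW : ∀ x, δ.IsCoreElement V x → ∀ z : W, x • z = 0) {x : R}
    (hx : δ.IsCoreElement W x) : δ.IsCoreElement V x := by
  obtain ⟨a, b, π, hπ, ha, hb, hk⟩ := exists_surjective_pi_tensor δ V hS
  have hWn : Nontrivial W := IsSimpleModule.nontrivial R W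
  obtain ⟨w, hw⟩ := exists_ne (0 : W)
  -- This nonzero map descends to (V ⊗ H)^b, so some component V ⊗ H → W is nonzero.
  let f : (Fin a → R) →ₗ[R] W := LinearMap.toSpanSingleton R W w ∘ₗ LinearMap.proj ⟨0, ha⟩
  obtain ⟨g, hg⟩ := LinearMap.exists_comp_eq_of_ker_le hπ f (smul_eq_zero_of_pi hW hk f)
  have hg0 : ∃ i, g ∘ₗ LinearMap.single R (fun _ => δ.Tensor V) i ≠ 0 := by
    by_contra! h
    have h0 : g = 0 := LinearMap.pi_ext' fun i => by rw [h i, LinearMap.zero_comp]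
    apply hw
    have := LinearMap.congr_fun hg (fun _ => 1)
    simpa [h0, f] using this.symm
  obtain ⟨i, hi⟩ := hg0
  exact hx.of_hom_tensor hi

/-- A simple module is projective relative to the modules annihilated by its core. -/
theorem exists_section_of_surjective [Module.Finite k R] [Module.Finite k H] [Module.Finite k V]
    [IsSimpleModule R V] (hS : Function.Injective (HopfAlgebra.antipode k : H →ₗ[k] H))
    {Λ : H} (hΛ : HopfAlgebra.IsNormalizedLeftIntegral (k := k) Λ)
    {Z : Type*} [AddCommGroup Z] [Module R Z]
    (hZ : ∀ x, δ.IsCoreElement V x → ∀ z : Z, x • z = 0) (q : Z →ₗ[R] V)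
    (hq : Function.Surjective q) : ∃ s : V →ₗ[R] Z, q ∘ₗ s = LinearMap.id := by
  obtain ⟨a, b, π, hπ, ha, hb, hk⟩ := exists_surjective_pi_tensor δ V hS
  -- v ↦ v ⊗ Λ is linear since x₁Λ = ε(x₁)Λ. The map τ = id ⊗ ε below retracts it because ε(Λ) = 1.
  let σ : V →ₗ[R] δ.Tensor V :=
    { toFun := fun v => (v ⊗ₜ[k] Λ : V ⊗[k] H)
      map_add' := fun v w => TensorProduct.add_tmul v w Λ
      map_smul' := fun x v => by
        have h1 : ∀ t : R ⊗[k] H, tensorRep V t (v ⊗ₜ Λ) =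
            (TensorProduct.contractSnd R (Coalgebra.counit (R := k)) t • v) ⊗ₜ Λ := by
          intro t
          induction t with
          | zero => simp
          | add x y hx hy => simp only [map_add, LinearMap.add_apply, hx, hy, add_smul,
              TensorProduct.add_tmul]
          | tmul r h =>
            rw [tensorRep_tmul, hΛ.mul_eq, TensorProduct.contractSnd_tmul, smul_assoc,
              TensorProduct.tmul_smul, TensorProduct.smul_tmul']
        have h2 := h1 (δ.map x)
        rw [δ.counit] at h2
        exact h2.symm }
  let τ : δ.Tensor V →ₗ[R] V :=
    { toFun := fun m => TensorProduct.contractSnd V (Coalgebra.counit (R := k) (A := H)) m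
      map_add' := fun v w => map_add _ _ _
      map_smul' := fun x m => by
        have h1 : ∀ (t : R ⊗[k] H) (m : V ⊗[k] H),
            TensorProduct.contractSnd V (Coalgebra.counit (R := k)) (tensorRep V t m) =
            TensorProduct.contractSnd R (Coalgebra.counit (R := k)) t •
              TensorProduct.contractSnd V (Coalgebra.counit (R := k)) m := by
          intro t m
          induction t with
          | zero => simp
          | add x y hx hy => simp only [map_add, LinearMap.add_apply, hx, hy, add_smul]
          | tmul r h =>
          induction m with
          | zero => simp
          | add x y hx hy => simp only [map_add, hx, hy, smul_add]
          | tmul v l =>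
            simp only [tensorRep_tmul, TensorProduct.contractSnd_tmul, Bialgebra.counit_mul,
              mul_smul, smul_assoc]
            rw [smul_comm r]
        have h2 := h1 (δ.map x) m
        rw [δ.counit] at h2
        exact h2 }
  have hτσ : τ ∘ₗ σ = LinearMap.id := by
    ext v
    change TensorProduct.contractSnd V (Coalgebra.counit (R := k)) (v ⊗ₜ[k] Λ) = v
    rw [TensorProduct.contractSnd_tmul, hΛ.counit_eq, one_smul]
  -- Lift through q on the free module R^a, then descend along π, which is possible because the core
  -- kills Z.
  obtain ⟨p, hp⟩ := Module.projective_lifting_property q (τ ∘ₗ LinearMap.proj ⟨0, hb⟩ ∘ₗ π) hq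
  obtain ⟨g, hg⟩ := LinearMap.exists_comp_eq_of_ker_le hπ p (smul_eq_zero_of_pi hZ hk p)
  have hqg : q ∘ₗ g = τ ∘ₗ LinearMap.proj ⟨0, hb⟩ := by
    rw [← LinearMap.cancel_right hπ, LinearMap.comp_assoc, hg, hp, LinearMap.comp_assoc]
  refine ⟨g ∘ₗ LinearMap.single R (fun _ => δ.Tensor V) ⟨0, hb⟩ ∘ₗ σ, ?_⟩
  rw [← LinearMap.comp_assoc, hqg, LinearMap.comp_assoc, ← LinearMap.comp_assoc _ _ (LinearMap.proj _),
    LinearMap.proj_comp_single_same, LinearMap.id_comp, hτσ]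

/-- The Jacobson radical is contained in the core of each simple module. -/
theorem isCoreElement_of_mem_jacobson [Module.Finite k R] [Module.Finite k H]
    [Module.Finite k V] [IsSimpleModule R V]
    (hS : Function.Injective (HopfAlgebra.antipode k : H →ₗ[k] H))
    {Λ : H} (hΛ : HopfAlgebra.IsNormalizedLeftIntegral (k := k) Λ) {x : R}
    (hx : x ∈ Ring.jacobson R) : δ.IsCoreElement V x := by
  let I : Ideal R := Module.annihilator R (δ.Tensor V)
  have hI : ∀ {y : R}, δ.IsCoreElement V y ↔ y ∈ I := fun {y} =>
    ⟨fun h => Module.mem_annihilator.2 h.smul_tensor,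
      fun h => isCoreElement_of_smul_tensor (Module.mem_annihilator.1 h)⟩
  have hkill : ∀ y, δ.IsCoreElement V y → ∀ z : R ⧸ I, y • z = 0 := by
    intro y hy z
    obtain ⟨r, rfl⟩ := I.mkQ_surjective z
    rw [← map_smul, Submodule.mkQ_apply, Submodule.Quotient.mk_eq_zero, smul_eq_mul]
    exact Module.mem_annihilator.2 fun m => by rw [mul_smul, hy.smul_tensor]
  have hss : IsSemisimpleModule R (R ⧸ I) := by
    rw [← sSup_simples_eq_top_iff_isSemisimpleModule]
    -- If the socle were proper, a maximal submodule c would contain it. The simple quotient by c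
    -- splits off, and its image lies in the socle, hence in c, which is absurd.
    by_contra hne
    obtain ⟨c, hc, hle⟩ := (eq_top_or_exists_le_coatom _).resolve_left hne
    have hQ : IsSimpleModule R ((R ⧸ I) ⧸ c) := isSimpleModule_iff_isCoatom.2 hc
    have hf1 : Module.Finite k (R ⧸ I) := Submodule.finite_quotient_of_isScalarTower k I
    have hf2 : Module.Finite k ((R ⧸ I) ⧸ c) := Submodule.finite_quotient_of_isScalarTower k c
    have hkill' : ∀ y, δ.IsCoreElement V y → ∀ z : (R ⧸ I) ⧸ c, y • z = 0 := by
      intro y hy z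
      obtain ⟨r, rfl⟩ := c.mkQ_surjective z
      rw [← map_smul, hkill y hy, map_zero]
    -- The core of this simple quotient is contained in that of V, so it kills R/I and relative
    -- projectivity applies.
    obtain ⟨s, hs⟩ := exists_section_of_surjective (V := (R ⧸ I) ⧸ c) hS hΛ
      (fun y hy => hkill y (IsCoreElement.of_simple hS hkill' hy)) c.mkQ c.mkQ_surjective
    have hinj : Function.Injective s := fun a b hab => by
      rw [← LinearMap.id_apply (R := R) a, ← LinearMap.id_apply (R := R) b, ← hs,
        LinearMap.comp_apply, hab, LinearMap.comp_apply]
    have hr : IsSimpleModule R (LinearMap.range s) :=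
      IsSimpleModule.congr (LinearEquiv.ofInjective s hinj).symm
    have hr' : LinearMap.range s ≤ c := le_trans (le_sSup hr) hle
    have hQn := IsSimpleModule.nontrivial R ((R ⧸ I) ⧸ c)
    obtain ⟨z, hz⟩ := exists_ne (0 : (R ⧸ I) ⧸ c)
    apply hz
    rw [← LinearMap.id_apply (R := R) z, ← hs, LinearMap.comp_apply, Submodule.mkQ_apply,
      Submodule.Quotient.mk_eq_zero]
    exact hr' ⟨z, rfl⟩
  rw [hI]
  have h1 := Module.mem_annihilator.1 (IsSemisimpleModule.jacobson_le_annihilator R (R ⧸ I) hx)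
    (I.mkQ 1)
  rwa [← map_smul, Submodule.mkQ_apply, Submodule.Quotient.mk_eq_zero, smul_eq_mul,
    mul_one] at h1

/-- The Jacobson radical of a finite-dimensional comodule algebra over a semisimple Hopf algebra
is stable under the coaction. -/
theorem coeff_mem_jacobson_of_finite [Module.Finite k R] [IsSemisimpleRing H]
    (δ : Coaction k H R) (f : Module.Dual k H) {x : R} (hx : x ∈ Ring.jacobson R) :
    δ.coeff f x ∈ Ring.jacobson R := by
  have := HopfAlgebra.finite_of_isSemisimpleRing k H
  obtain ⟨Λ, hΛ⟩ := HopfAlgebra.exists_isNormalizedLeftIntegral k H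
  rw [Ring.jacobson_eq_sInf_isMaximal, Submodule.mem_sInf]
  intro 𝔪 h𝔪
  have hV : IsSimpleModule R (R ⧸ 𝔪) := isSimpleModule_iff_isCoatom.2 (show Ideal.IsMaximal (α := R) 𝔪 from h𝔪).out
  have hVf : Module.Finite k (R ⧸ 𝔪) := Submodule.finite_quotient_of_isScalarTower k 𝔪
  -- Coefficients of x kill R/𝔪; applied to the class of 1 this puts them in 𝔪.
  have h1 := isCoreElement_of_mem_jacobson (δ := δ) (V := R ⧸ 𝔪)
    (HopfAlgebra.antipode_injective_of_isSemisimpleRing k H) hΛ hx f (𝔪.mkQ 1)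
  rwa [← map_smul, Submodule.mkQ_apply, Submodule.Quotient.mk_eq_zero, smul_eq_mul,
    mul_one] at h1

end Coaction

/-! ### Passing from finite-dimensional to locally finite comodule algebras. -/

theorem Ring.mem_jacobson_iff_exists_mul {R : Type*} [Ring R] {x : R} :
    x ∈ Ring.jacobson R ↔ ∀ y, ∃ z, z * (y * x + 1) = 1 := by
  rw [← Ideal.jacobson_bot, Ideal.mem_jacobson_iff]
  refine forall_congr' fun y => exists_congr fun z => ?_
  rw [Submodule.mem_bot, sub_eq_zero, mul_add, mul_one, mul_assoc]

/-- A left inverse of yx + 1 in R makes left multiplication by yx + 1 injective on S, hence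
surjective by finite dimension. The resulting right inverse in S coincides with the left inverse. -/
theorem Subalgebra.mem_jacobson_of_finite {k R : Type*} [Field k] [Ring R] [Algebra k R]
    (S : Subalgebra k R) [Module.Finite k S] {x : S} (hx : (x : R) ∈ Ring.jacobson R) :
    x ∈ Ring.jacobson S := by
  rw [Ring.mem_jacobson_iff_exists_mul] at hx ⊢
  intro y
  obtain ⟨z, hz⟩ := hx y
  have hinj : Function.Injective (LinearMap.mulLeft k (y * x + 1)) := by
    intro a b hab
    have h1 : ((y : R) * x + 1) * a = (y * x + 1) * b := congrArg Subtype.val hab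
    apply Subtype.ext
    rw [← one_mul (a : R), ← one_mul (b : R), ← hz, mul_assoc, h1, mul_assoc]
  obtain ⟨w, hw⟩ := LinearMap.injective_iff_surjective.1 hinj 1
  refine ⟨w, ?_⟩
  have h1 : ((y : R) * x + 1) * w = 1 := congrArg Subtype.val hw
  have h2 : (w : R) = z := by
    rw [← one_mul (w : R), ← hz, mul_assoc, h1, mul_one]
  apply Subtype.ext
  change (w : R) * (y * x + 1) = 1
  rw [h2, hz]

/-- All contractions of the image of t in (X/S) ⊗ Y vanish, so that image is zero and exactness
places t in the image of S ⊗ Y. -/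
theorem TensorProduct.mem_range_rTensor_of_contractSnd {k X Y : Type*} [Field k] [AddCommGroup X]
    [Module k X] [AddCommGroup Y] [Module k Y] (S : Submodule k X) {t : X ⊗[k] Y}
    (h : ∀ f : Module.Dual k Y, TensorProduct.contractSnd X f t ∈ S) :
    t ∈ LinearMap.range (S.subtype.rTensor Y) := by
  have hex : Function.Exact S.subtype S.mkQ := LinearMap.exact_subtype_mkQ S
  refine (rTensor_exact Y hex S.mkQ_surjective t).1 ?_
  apply TensorProduct.eq_zero_of_contractSnd
  intro f
  have h1 : ∀ t : X ⊗[k] Y, TensorProduct.contractSnd (X ⧸ S) f (S.mkQ.rTensor Y t) =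
      S.mkQ (TensorProduct.contractSnd X f t) := by
    intro t
    induction t with
    | zero => simp
    | add x y hx hy => simp only [map_add, hx, hy]
    | tmul r h => simp
  rw [h1, Submodule.mkQ_apply, Submodule.Quotient.mk_eq_zero]
  exact h f

theorem TensorProduct.contractSnd_eq_sum {k X Y ι : Type*} [Field k] [AddCommGroup X]
    [Module k X] [AddCommGroup Y] [Module k Y] [Fintype ι] (b : Module.Basis ι k Y)
    (f : Module.Dual k Y) (t : X ⊗[k] Y) :
    TensorProduct.contractSnd X f t =
      ∑ i, f (b i) • TensorProduct.contractSnd X (b.coord i) t := by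
  induction t with
  | zero => simp
  | add x y hx hy => simp only [map_add, hx, hy, smul_add, Finset.sum_add_distrib]
  | tmul x y =>
    simp only [TensorProduct.contractSnd_tmul, smul_smul]
    rw [← Finset.sum_smul]
    congr 1
    conv_lhs => rw [← b.sum_repr y, map_sum]
    simp [mul_comm]

namespace Coaction

variable {k H R : Type*} [Field k] [Ring H] [HopfAlgebra k H] [Ring R] [Algebra k R]
  (δ : Coaction k H R) (S : Subalgebra k R)

/-- The inclusion `S ⊗ H → R ⊗ H` for a subalgebra `S` of `R`. -/
noncomputable def inclTensor (k H : Type*) {R : Type*} [Field k] [Ring H] [HopfAlgebra k H]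
    [Ring R] [Algebra k R] (S : Subalgebra k R) : S ⊗[k] H →ₐ[k] R ⊗[k] H :=
  Algebra.TensorProduct.map S.val (AlgHom.id k H)

theorem inclTensor_tmul (s : S) (h : H) : inclTensor k H S (s ⊗ₜ h) = (s : R) ⊗ₜ h := rfl

theorem inclTensor_injective : Function.Injective (inclTensor k H S) :=
  Module.Flat.rTensor_preserves_injective_linearMap (M := H) S.toSubmodule.subtype
    Subtype.val_injective

theorem contractSnd_inclTensor (f : Module.Dual k H) (t : S ⊗[k] H) :
    TensorProduct.contractSnd R f (inclTensor k H S t) = TensorProduct.contractSnd S f t := by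
  induction t with
  | zero => simp
  | add x y hx hy => simp only [map_add, hx, hy, Subalgebra.coe_add]
  | tmul r h => simp [inclTensor_tmul]

variable {δ S}

theorem map_mem_range_inclTensor {x : R} (h : ∀ f, δ.coeff f x ∈ S) :
    δ.map x ∈ (inclTensor k H S).range := by
  obtain ⟨t, ht⟩ := TensorProduct.mem_range_rTensor_of_contractSnd S.toSubmodule (t := δ.map x) h
  exact ⟨t, ht⟩

theorem coeff_mem_of_map_mem_range {x : R} (h : δ.map x ∈ (inclTensor k H S).range)
    (f : Module.Dual k H) : δ.coeff f x ∈ S := by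
  obtain ⟨t, ht⟩ := h
  have h1 : δ.coeff f x = TensorProduct.contractSnd R f (inclTensor k H S t) :=
    congrArg (TensorProduct.contractSnd R f) ht.symm
  rw [h1, contractSnd_inclTensor]
  exact Subtype.property _

variable (δ) in
/-- The restriction of the coaction map to a stable subalgebra. -/
noncomputable def restrictMap (hS : ∀ x ∈ S, ∀ f, δ.coeff f x ∈ S) : S →ₐ[k] S ⊗[k] H :=
  ((AlgEquiv.ofInjective _ (inclTensor_injective (k := k) (H := H) S)).symm : _ →ₐ[k] _).comp
    ((δ.map.comp S.val).codRestrict _ fun x => map_mem_range_inclTensor (hS x x.2))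

theorem inclTensor_restrictMap (hS : ∀ x ∈ S, ∀ f, δ.coeff f x ∈ S) (x : S) :
    inclTensor k H S (δ.restrictMap hS x) = δ.map x :=
  congrArg Subtype.val ((AlgEquiv.ofInjective _
    (inclTensor_injective (k := k) (H := H) S)).apply_symm_apply
    ((δ.map.comp S.val).codRestrict _ (fun x => map_mem_range_inclTensor (hS x x.2)) x))

variable (δ) in
/-- The restriction of a coaction to a stable subalgebra. -/
noncomputable def restrict (hS : ∀ x ∈ S, ∀ f, δ.coeff f x ∈ S) : Coaction k H S where
  map := δ.restrictMap hS
  coassoc x := by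
    -- S ⊗ H ⊗ H embeds into R ⊗ H ⊗ H by flatness, so coassociativity is inherited from R.
    apply Module.Flat.rTensor_preserves_injective_linearMap (M := H ⊗[k] H)
      S.toSubmodule.subtype Subtype.val_injective
    have h1 : ∀ (z : S ⊗[k] H) (h : H), S.toSubmodule.subtype.rTensor (H ⊗[k] H)
        (TensorProduct.assoc k S H H (z ⊗ₜ h)) =
        TensorProduct.assoc k R H H (inclTensor k H S z ⊗ₜ h) := by
      intro z h
      induction z with
      | zero => rw [TensorProduct.zero_tmul, LinearEquiv.map_zero, LinearMap.map_zero, map_zero,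
          TensorProduct.zero_tmul, LinearEquiv.map_zero]
      | add x y hx hy => rw [TensorProduct.add_tmul, LinearEquiv.map_add, LinearMap.map_add, hx, hy,
          map_add, TensorProduct.add_tmul, LinearEquiv.map_add]
      | tmul a b => rfl
    have h2 : ∀ t : S ⊗[k] H, S.toSubmodule.subtype.rTensor (H ⊗[k] H)
        (TensorProduct.assoc k S H H ((δ.restrictMap hS).toLinearMap.rTensor H t)) =
        TensorProduct.assoc k R H H (δ.map.toLinearMap.rTensor H (inclTensor k H S t)) := by
      intro t
      induction t with
      | zero => simp
      | add x y hx hy => simp only [map_add, hx, hy]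
      | tmul a b =>
        rw [LinearMap.rTensor_tmul, inclTensor_tmul, LinearMap.rTensor_tmul, h1]
        exact congrArg (fun z => TensorProduct.assoc k R H H (z ⊗ₜ b))
          (inclTensor_restrictMap hS a)
    have h3 : ∀ t : S ⊗[k] H, S.toSubmodule.subtype.rTensor (H ⊗[k] H)
        ((Coalgebra.comul (R := k)).lTensor S t) =
        (Coalgebra.comul (R := k)).lTensor R (inclTensor k H S t) := by
      intro t
      induction t with
      | zero => simp
      | add x y hx hy => simp only [map_add, hx, hy]
      | tmul a b => rfl
    refine (h2 _).trans (Eq.trans ?_ (h3 _).symm)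
    rw [inclTensor_restrictMap]
    exact δ.coassoc x
  counit x := by
    apply Subtype.ext
    rw [← contractSnd_inclTensor, inclTensor_restrictMap, δ.counit]

theorem restrict_coeff (hS : ∀ x ∈ S, ∀ f, δ.coeff f x ∈ S) (f : Module.Dual k H) (x : S) :
    ((δ.restrict hS).coeff f x : R) = δ.coeff f x :=
  (contractSnd_inclTensor S f _).symm.trans
    (congrArg (TensorProduct.contractSnd R f) (inclTensor_restrictMap hS x))

variable (δ) in
/-- Two elements of a locally finite comodule algebra lie in a finite-dimensional stable
subalgebra. -/
theorem exists_finite_stable_subalgebra [Module.Finite k H] (hR : IsLocallyFiniteAlgebra k R)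
    (x y : R) : ∃ S : Subalgebra k R, Module.Finite k S ∧ x ∈ S ∧ y ∈ S ∧
      ∀ z ∈ S, ∀ f, δ.coeff f z ∈ S := by
  classical
  let b := Module.finBasis k H
  -- These generators span all coefficients of x and y, including x and y themselves as counit
  -- coefficients.
  let T : Finset R := Finset.univ.image (fun i => δ.coeff (b.coord i) x) ∪
    Finset.univ.image (fun i => δ.coeff (b.coord i) y)
  let S := Algebra.adjoin k (T : Set R)
  have hc : ∀ z : R, (∀ i, δ.coeff (b.coord i) z ∈ S) → ∀ f, δ.coeff f z ∈ S := by
    intro z hz f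
    have h1 : δ.coeff f z = ∑ i, f (b i) • δ.coeff (b.coord i) z :=
      TensorProduct.contractSnd_eq_sum b f (δ.map z)
    rw [h1]
    exact sum_mem fun i _ => S.smul_mem (hz i) _
  have hx : ∀ f, δ.coeff f x ∈ S := hc x fun i => Algebra.subset_adjoin (by simp [T])
  have hy : ∀ f, δ.coeff f y ∈ S := hc y fun i => Algebra.subset_adjoin (by simp [T])
  refine ⟨S, hR T, ?_, ?_, ?_⟩
  · rw [← δ.coeff_counit x]; exact hx _
  · rw [← δ.coeff_counit y]; exact hy _
  -- The elements whose coaction lies in S ⊗ H form a subalgebra, so stability need only be checked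
  -- on generators.
  · have hle : S ≤ (inclTensor k H S).range.comap δ.map := by
      refine Algebra.adjoin_le ?_
      intro z hz
      have h1 : ∀ f, δ.coeff f z ∈ S := by
        intro f
        simp only [T, Finset.coe_union, Finset.coe_image, Finset.coe_univ, Set.image_univ,
          Set.mem_union, Set.mem_range] at hz
        obtain ⟨i, rfl⟩ | ⟨i, rfl⟩ := hz
        · rw [coeff_coeff]; exact hx _
        · rw [coeff_coeff]; exact hy _
      exact map_mem_range_inclTensor h1
    exact fun z hz => coeff_mem_of_map_mem_range (hle hz)

variable (δ) in
/-- The Jacobson radical of a locally finite comodule algebra over a semisimple Hopf algebra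
is stable under the coaction. -/
theorem coeff_mem_jacobson [IsSemisimpleRing H] (hR : IsLocallyFiniteAlgebra k R)
    (f : Module.Dual k H) {x : R} (hx : x ∈ Ring.jacobson R) :
    δ.coeff f x ∈ Ring.jacobson R := by
  have := HopfAlgebra.finite_of_isSemisimpleRing k H
  rw [Ring.mem_jacobson_iff_exists_mul]
  intro y
  -- The criterion for the radical involves one y at a time, so a finite-dimensional stable
  -- subalgebra containing x and y suffices.
  obtain ⟨S, hSf, hxS, hyS, hS⟩ := δ.exists_finite_stable_subalgebra hR x y
  have h1 := (δ.restrict hS).coeff_mem_jacobson_of_finite f (x := ⟨x, hxS⟩)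
    (S.mem_jacobson_of_finite hx)
  obtain ⟨z, hz⟩ := Ring.mem_jacobson_iff_exists_mul.1 h1 ⟨y, hyS⟩
  refine ⟨z, ?_⟩
  have h2 := congrArg Subtype.val hz
  rw [← restrict_coeff hS f ⟨x, hxS⟩]
  exact h2

end Coaction

/-! ### The coaction on the partial smash product and its stable radical. -/

namespace PartialAction

section SmashCoaction

variable {k : Type u} {H : Type v} {A : Type w} [Field k] [Ring H] [HopfAlgebra k H]
  [Ring A] [Algebra k A] (α : PartialAction k H A)

theorem PartialSmash.val_mul {α : PartialAction k H A} (x y : α.PartialSmash) :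
    (x * y).val = α.smashMul x.val y.val := rfl

theorem PartialSmash.val_injective {α : PartialAction k H A} :
    Function.Injective (PartialSmash.val (α := α)) := Subtype.val_injective

/-- The inclusion of the partial smash product into `A ⊗ H` as a linear map. -/
noncomputable def PartialSmash.valₗ : α.PartialSmash →ₗ[k] A ⊗[k] H := α.partialSmashSubmodule.subtype

/-- The projection `y ↦ y (1 # 1)` of `A # H` onto the partial smash product. -/
noncomputable def toSmash : A ⊗[k] H →ₗ[k] α.PartialSmash :=
  (α.smashMul.flip (1 ⊗ₜ[k] 1)).rangeRestrict

theorem val_toSmash (y : A ⊗[k] H) : (α.toSmash y).val = α.smashMul y (1 ⊗ₜ[k] 1) := rfl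

theorem toSmash_val (x : α.PartialSmash) : α.toSmash x.val = x :=
  PartialSmash.val_injective (α.smashMul_one_of_mem x.property)

/-- Since 1 # 1 is a left identity, x(1 # 1)y(1 # 1) = xy(1 # 1). -/
theorem toSmash_smashMul (x y : A ⊗[k] H) :
    α.toSmash (α.smashMul x y) = α.toSmash x * α.toSmash y := by
  apply PartialSmash.val_injective
  rw [PartialSmash.val_mul, val_toSmash, val_toSmash, val_toSmash, α.smashMul_assoc,
    α.smashMul_assoc, α.one_smashMul]

theorem toSmash_one : α.toSmash (1 ⊗ₜ[k] 1) = 1 :=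
  PartialSmash.val_injective (α.one_smashMul (1 ⊗ₜ[k] 1))

theorem smashMul_val_one (x : α.PartialSmash) : α.smashMul x.val (1 ⊗ₜ[k] 1) = x.val :=
  α.smashMul_one_of_mem x.property

/-- The map `id ⊗ Δ` is multiplicative on `A # H`. -/
theorem tensorCoaction_smashMul (x y : A ⊗[k] H) :
    Coaction.tensorCoaction A (α.smashMul x y) =
      TensorProduct.map₂ α.smashMul (LinearMap.mul k H)
        (Coaction.tensorCoaction A x) (Coaction.tensorCoaction A y) := by
  induction x with
  | zero => simp
  | add x x' hx hx' => simp only [map_add, LinearMap.add_apply, hx, hx']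
  | tmul a h =>
  induction y with
  | zero => simp
  | add y y' hy hy' => simp only [map_add, hy, hy']
  | tmul b g =>
  -- Both sides are a(h₁ · b) ⊗ h₂g₁ ⊗ h₃g₂, that is, K on the two bracketings of the iterated
  -- coproduct of h.
  let K : H ⊗[k] (H ⊗[k] H) →ₗ[k] (A ⊗[k] H) ⊗[k] H :=
    (TensorProduct.assoc k A H H).symm.toLinearMap ∘ₗ
      TensorProduct.map (LinearMap.mulLeft k a ∘ₗ α.act.flip b)
        (LinearMap.mulRight k (Coalgebra.comul (R := k) g))
  have h1 : ∀ t : H ⊗[k] H, Coaction.tensorCoaction A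
      (TensorProduct.map (LinearMap.mulLeft k a ∘ₗ α.act.flip b) (LinearMap.mulRight k g) t) =
      K ((Coalgebra.comul (R := k)).lTensor H t) := by
    intro t
    induction t with
    | zero => simp
    | add x y hx hy => simp only [map_add, hx, hy]
    | tmul u v => simp [Coaction.tensorCoaction, K, Bialgebra.comul_mul]
  have h2 : ∀ t : H ⊗[k] H, TensorProduct.map₂ α.smashMul (LinearMap.mul k H)
      ((TensorProduct.assoc k A H H).symm (a ⊗ₜ t)) (Coaction.tensorCoaction A (b ⊗ₜ g)) =
      K (TensorProduct.assoc k H H H ((Coalgebra.comul (R := k)).rTensor H t)) := by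
    intro t
    simp only [Coaction.tensorCoaction, K, LinearMap.comp_apply, LinearMap.lTensor_tmul,
      LinearEquiv.coe_coe]
    generalize Coalgebra.comul (R := k) g = s
    induction t with
    | zero => simp
    | add x y hx hy => simp only [map_add, LinearMap.add_apply, TensorProduct.tmul_add, hx, hy]
    | tmul u v =>
      induction s with
      | zero => simp
      | add x y hx hy =>
        rw [TensorProduct.tmul_add, map_add, map_add, hx, hy,
          show LinearMap.mulRight k (x + y) = LinearMap.mulRight k x + LinearMap.mulRight k y
            by ext; simp [mul_add], TensorProduct.map_add_right, LinearMap.add_apply, map_add]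
      | tmul p q =>
        rw [TensorProduct.assoc_symm_tmul, TensorProduct.assoc_symm_tmul,
          TensorProduct.map₂_apply_tmul, TensorProduct.map_tmul, smashMul_tmul, LinearMap.rTensor_tmul]
        generalize Coalgebra.comul (R := k) u = z
        induction z with
        | zero => simp
        | add x y hx hy => simp only [map_add, TensorProduct.add_tmul, hx, hy]
        | tmul c d => simp
  rw [smashMul_tmul, h1]
  refine Eq.trans ?_ (h2 (Coalgebra.comul (R := k) h)).symm
  rw [Coalgebra.coassoc_apply]

theorem tensorCoaction_one :
    Coaction.tensorCoaction A (1 ⊗ₜ[k] (1 : H)) = (1 ⊗ₜ[k] 1) ⊗ₜ[k] 1 := by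
  simp [Coaction.tensorCoaction, Algebra.TensorProduct.one_def]

/-- Right multiplication by 1 # 1 is colinear because Δ(1) = 1 ⊗ 1; this is what lets the coaction
restrict to the partial smash product. -/
theorem tensorCoaction_smashMul_one (y : A ⊗[k] H) :
    Coaction.tensorCoaction A (α.smashMul y (1 ⊗ₜ[k] 1)) =
      (α.smashMul.flip (1 ⊗ₜ[k] 1)).rTensor H (Coaction.tensorCoaction A y) := by
  rw [tensorCoaction_smashMul, tensorCoaction_one]
  generalize Coaction.tensorCoaction A y = t
  induction t with
  | zero => simp
  | add x y hx hy => simp only [map_add, LinearMap.add_apply, hx, hy]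
  | tmul u v => simp

/-- The coaction on the partial smash product as a linear map. -/
noncomputable def smashCoactionₗ : α.PartialSmash →ₗ[k] α.PartialSmash ⊗[k] H :=
  α.toSmash.rTensor H ∘ₗ Coaction.tensorCoaction A ∘ₗ PartialSmash.valₗ α

theorem smashCoactionₗ_apply (x : α.PartialSmash) :
    α.smashCoactionₗ x = α.toSmash.rTensor H (Coaction.tensorCoaction A x.val) := rfl

theorem smashCoactionₗ_toSmash (y : A ⊗[k] H) :
    α.smashCoactionₗ (α.toSmash y) = α.toSmash.rTensor H (Coaction.tensorCoaction A y) := by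
  rw [smashCoactionₗ_apply, val_toSmash, tensorCoaction_smashMul_one, ← LinearMap.comp_apply,
    ← LinearMap.rTensor_comp]
  congr 2
  ext a h
  simp only [TensorProduct.AlgebraTensorModule.curry_apply, TensorProduct.curry_apply,
    LinearMap.coe_restrictScalars, LinearMap.comp_apply, LinearMap.flip_apply]
  rw [toSmash_smashMul, toSmash_one, mul_one]

/-- The partial smash product is a right `H`-comodule algebra. -/
noncomputable def smashCoaction : Coaction k H α.PartialSmash where
  map := AlgHom.ofLinearMap α.smashCoactionₗ
    (by
      rw [← α.toSmash_one, smashCoactionₗ_toSmash, tensorCoaction_one, LinearMap.rTensor_tmul,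
        toSmash_one, Algebra.TensorProduct.one_def])
    (fun x y => by
      rw [smashCoactionₗ_apply, smashCoactionₗ_apply, smashCoactionₗ_apply, PartialSmash.val_mul,
        tensorCoaction_smashMul]
      generalize Coaction.tensorCoaction A x.val = s
      generalize Coaction.tensorCoaction A y.val = t
      induction s with
      | zero => simp
      | add x y hx hy => simp only [map_add, LinearMap.add_apply, add_mul, hx, hy]
      | tmul a b =>
      induction t with
      | zero => simp
      | add x y hx hy => simp only [map_add, mul_add, hx, hy]
      | tmul c d =>
        rw [TensorProduct.map₂_apply_tmul, TensorProduct.map_tmul, LinearMap.rTensor_tmul,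
          LinearMap.rTensor_tmul,
          LinearMap.rTensor_tmul, toSmash_smashMul, Algebra.TensorProduct.tmul_mul_tmul,
          LinearMap.mul_apply'])
  coassoc x := by
    change TensorProduct.assoc k _ H H (α.smashCoactionₗ.rTensor H (α.smashCoactionₗ x)) =
      (Coalgebra.comul (R := k)).lTensor _ (α.smashCoactionₗ x)
    rw [smashCoactionₗ_apply]
    have h1 : ∀ t : (A ⊗[k] H) ⊗[k] H, TensorProduct.assoc k _ H H
        (α.smashCoactionₗ.rTensor H (α.toSmash.rTensor H t)) =
        α.toSmash.rTensor (H ⊗[k] H) (TensorProduct.assoc k (A ⊗[k] H) H H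
          ((Coaction.tensorCoaction A).rTensor H t)) := by
      intro t
      induction t with
      | zero => simp
      | add x y hx hy => simp only [map_add, hx, hy]
      | tmul y h =>
        rw [LinearMap.rTensor_tmul, LinearMap.rTensor_tmul, LinearMap.rTensor_tmul,
          smashCoactionₗ_toSmash]
        generalize Coaction.tensorCoaction A y = s
        induction s with
        | zero => simp
        | add x y hx hy => simp only [map_add, TensorProduct.add_tmul, hx, hy]
        | tmul a b => simp
    have h2 : ∀ t : (A ⊗[k] H) ⊗[k] H, (Coalgebra.comul (R := k)).lTensor _
        (α.toSmash.rTensor H t) = α.toSmash.rTensor (H ⊗[k] H)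
          ((Coalgebra.comul (R := k)).lTensor _ t) := by
      intro t
      induction t with
      | zero => simp
      | add x y hx hy => simp only [map_add, hx, hy]
      | tmul y h => simp
    rw [h1, h2, Coaction.tensorCoaction_coassoc]
  counit x := by
    change TensorProduct.contractSnd _ _ (α.smashCoactionₗ x) = x
    have h1 : ∀ t : (A ⊗[k] H) ⊗[k] H, TensorProduct.contractSnd α.PartialSmash
        (Coalgebra.counit (R := k)) (α.toSmash.rTensor H t) =
        α.toSmash (TensorProduct.contractSnd _ (Coalgebra.counit (R := k)) t) := by
      intro t
      induction t with
      | zero => simp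
      | add x y hx hy => simp only [map_add, hx, hy]
      | tmul y h => simp
    rw [smashCoactionₗ_apply, h1, Coaction.tensorCoaction_contract, toSmash_val]

theorem val_smashCoaction_coeff (f : Module.Dual k H) (x : α.PartialSmash) :
    (α.smashCoaction.coeff f x).val =
      TensorProduct.contractSnd _ f (Coaction.tensorCoaction A x.val) := by
  have h1 : ∀ t : (A ⊗[k] H) ⊗[k] H, (TensorProduct.contractSnd α.PartialSmash f
      (α.toSmash.rTensor H t)).val = TensorProduct.contractSnd _ f
        ((α.smashMul.flip (1 ⊗ₜ[k] 1)).rTensor H t) := by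
    intro t
    change PartialSmash.valₗ α _ = _
    induction t with
    | zero => simp
    | add x y hx hy => simp only [map_add, hx, hy]
    | tmul y h =>
      simp only [LinearMap.rTensor_tmul, TensorProduct.contractSnd_tmul, map_smul]
      rfl
  have h2 := h1 (Coaction.tensorCoaction A x.val)
  rw [← tensorCoaction_smashMul_one, α.smashMul_val_one x] at h2
  exact h2

/-- The identity ε(h₁)f(h₂) = f(h) turns an arbitrary contraction of x into the ε-contraction of a
coefficient of x. -/
theorem contractSnd_counit_coeff (f : Module.Dual k H) (x : α.PartialSmash) :
    TensorProduct.contractSnd A (Coalgebra.counit (R := k)) (α.smashCoaction.coeff f x).val =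
      TensorProduct.contractSnd A f x.val := by
  rw [val_smashCoaction_coeff]
  generalize x.val = t
  induction t with
  | zero => simp
  | add x y hx hy => simp only [map_add, hx, hy]
  | tmul a h =>
    have h1 : ∀ s : H ⊗[k] H, TensorProduct.contractSnd A (Coalgebra.counit (R := k))
        (TensorProduct.contractSnd (A ⊗[k] H) f ((TensorProduct.assoc k A H H).symm (a ⊗ₜ s))) =
        f (TensorProduct.lid k H ((Coalgebra.counit (R := k)).rTensor H s)) • a := by
      intro s
      induction s with
      | zero => simp
      | add x y hx hy => simp only [map_add, TensorProduct.tmul_add, hx, hy, add_smul]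
      | tmul p q => simp [smul_smul, mul_comm]
    rw [Coaction.tensorCoaction, LinearMap.comp_apply, LinearMap.lTensor_tmul, LinearEquiv.coe_coe,
      h1, Coalgebra.rTensor_counit_comul]
    simp

/-- The map `r ⊗ h ↦ r (1 # S(h)) (1 # 1)`. -/
noncomputable def mulAntipode : α.PartialSmash ⊗[k] H →ₗ[k] α.PartialSmash :=
  LinearMap.mul' k α.PartialSmash ∘ₗ
    (α.toSmash ∘ₗ TensorProduct.mk k A H 1 ∘ₗ HopfAlgebra.antipode k).lTensor _

theorem mulAntipode_tmul (r : α.PartialSmash) (h : H) :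
    α.mulAntipode (r ⊗ₜ h) = r * α.toSmash (1 ⊗ₜ HopfAlgebra.antipode k h) := by
  simp [mulAntipode]

/-- For x = (a # h)(1 # 1), up to the projection y ↦ y(1 # 1), one has (a # h₁)(1 # S(h₂)) = a(h₁ ·
1) # h₂S(h₃) = a(h · 1) # 1, and a(h · 1) is the ε-contraction of x. -/
theorem mulAntipode_smashCoaction (x : α.PartialSmash) :
    α.mulAntipode (α.smashCoaction.map x) =
      α.toSmash (TensorProduct.contractSnd A (Coalgebra.counit (R := k)) x.val ⊗ₜ 1) := by
  have h1 : ∀ y : A ⊗[k] H, α.mulAntipode (α.toSmash.rTensor H (Coaction.tensorCoaction A y)) =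
      α.toSmash (TensorProduct.contractSnd A (Coalgebra.counit (R := k))
        (α.smashMul y (1 ⊗ₜ[k] 1)) ⊗ₜ 1) := by
    intro y
    induction y with
    | zero => simp
    | add x y hx hy => simp only [map_add, LinearMap.add_apply, TensorProduct.add_tmul, hx, hy]
    | tmul a h =>
      let f : H →ₗ[k] A := LinearMap.mulLeft k a ∘ₗ α.act.flip 1
      let K : H ⊗[k] (H ⊗[k] H) →ₗ[k] A ⊗[k] H :=
        TensorProduct.map f (LinearMap.mul' k H ∘ₗ (HopfAlgebra.antipode k).lTensor H)
      have h2 : ∀ s : H ⊗[k] H, α.mulAntipode (α.toSmash.rTensor H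
          ((TensorProduct.assoc k A H H).symm (a ⊗ₜ s))) =
          α.toSmash (K (TensorProduct.assoc k H H H ((Coalgebra.comul (R := k)).rTensor H s))) := by
        intro s
        induction s with
        | zero => simp
        | add x y hx hy => simp only [map_add, TensorProduct.tmul_add, hx, hy]
        | tmul p q =>
          rw [TensorProduct.assoc_symm_tmul, LinearMap.rTensor_tmul, mulAntipode_tmul,
            ← toSmash_smashMul, smashMul_tmul, LinearMap.rTensor_tmul]
          congr 1
          generalize Coalgebra.comul (R := k) p = z
          induction z with
          | zero => simp
          | add x y hx hy => simp only [map_add, TensorProduct.add_tmul, hx, hy]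
          | tmul c d => simp [K, f]
      have h3 : ∀ s : H ⊗[k] H, K ((Coalgebra.comul (R := k)).lTensor H s) =
          TensorProduct.contractSnd A (Coalgebra.counit (R := k))
            (TensorProduct.map f (LinearMap.mulRight k 1) s) ⊗ₜ 1 := by
        intro s
        induction s with
        | zero => simp
        | add x y hx hy => simp only [map_add, TensorProduct.add_tmul, hx, hy]
        | tmul p q =>
          simp only [LinearMap.lTensor_tmul, K, TensorProduct.map_tmul, LinearMap.comp_apply,
            HopfAlgebra.mul_antipode_lTensor_comul_apply, TensorProduct.contractSnd_tmul,
            LinearMap.mulRight_apply, mul_one, Algebra.algebraMap_eq_smul_one]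
          rw [TensorProduct.tmul_smul, TensorProduct.smul_tmul']
      rw [smashMul_tmul, ← h3, ← Coalgebra.coassoc_apply, ← h2]
      rfl
  refine (h1 x.val).trans ?_
  rw [α.smashMul_val_one x]

/-- A stable Jacobson radical that meets `A` trivially is zero. -/
theorem jacobson_eq_bot_of_stable
    (hst : ∀ (f : Module.Dual k H) (x : α.PartialSmash), x ∈ Ring.jacobson α.PartialSmash →
      α.smashCoaction.coeff f x ∈ Ring.jacobson α.PartialSmash)
    (hA : ∀ a : A, α.toSmash (a ⊗ₜ 1) ∈ Ring.jacobson α.PartialSmash → a = 0) :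
    Ring.jacobson α.PartialSmash = ⊥ := by
  have h0 : ∀ x ∈ Ring.jacobson α.PartialSmash,
      TensorProduct.contractSnd A (Coalgebra.counit (R := k)) x.val = 0 := by
    intro x hx
    apply hA
    rw [← mulAntipode_smashCoaction]
    -- Stability means that the coaction sends x into J ⊗ H. Multiplying out with the antipode stays
    -- in J because J is also a right ideal.
    obtain ⟨t, ht⟩ := TensorProduct.mem_range_rTensor_of_contractSnd
      ((Ring.jacobson α.PartialSmash).restrictScalars k) (t := α.smashCoaction.map x)
      (fun f => hst f x hx)
    rw [← ht]
    clear ht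
    induction t with
    | zero => simp
    | add x y hx hy => rw [map_add, map_add]; exact Submodule.add_mem _ hx hy
    | tmul r h =>
      rw [LinearMap.rTensor_tmul, mulAntipode_tmul]
      exact Ideal.mul_mem_right _ _ r.2
  rw [eq_bot_iff]
  intro x hx
  rw [Submodule.mem_bot]
  apply PartialSmash.val_injective
  apply TensorProduct.eq_zero_of_contractSnd
  intro f
  rw [← contractSnd_counit_coeff]
  exact h0 _ (hst f x hx)

end SmashCoaction

/-! ### Local finiteness of the partial smash product. -/

section LocallyFinite

variable {k : Type u} {H : Type v} {A : Type w} [Field k] [Ring H] [HopfAlgebra k H]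
  [Ring A] [Algebra k A] (α : PartialAction k H A)

/-- Every finite subset of a locally finite partial `H`-module algebra lies in a
finite-dimensional stable subalgebra. -/
theorem exists_finite_stable_subalgebra [Module.Finite k H] (hA : IsLocallyFiniteAlgebra k A)
    (s : Finset A) : ∃ B : Subalgebra k A, Module.Finite k B ∧ (∀ a ∈ s, a ∈ B) ∧
      ∀ b ∈ B, ∀ h : H, α.act h b ∈ B := by
  classical
  let e := Module.finBasis k H
  -- The unit is included because a partial action need not satisfy h · 1 = ε(h)1, and h · (g · a) =
  -- (h₁ · 1)((h₂g) · a) involves h₁ · 1.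
  let T : Finset A := (insert 1 s).biUnion fun a => Finset.univ.image fun i => α.act (e i) a
  let B := Algebra.adjoin k (T : Set A)
  have hs : ∀ a ∈ insert 1 s, ∀ h : H, α.act h a ∈ B := by
    intro a ha h
    rw [← e.sum_repr h, map_sum, LinearMap.sum_apply]
    refine sum_mem fun i _ => ?_
    rw [map_smul, LinearMap.smul_apply]
    refine B.smul_mem (Algebra.subset_adjoin ?_) _
    exact Finset.mem_coe.2 (Finset.mem_biUnion.2 ⟨a, ha, Finset.mem_image.2 ⟨i, by simp, rfl⟩⟩)
  have key : ∀ (p q : H →ₗ[k] A) (t : H ⊗[k] H), (∀ h, p h ∈ B) → (∀ h, q h ∈ B) →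
      LinearMap.mul' k A (TensorProduct.map p q t) ∈ B := by
    intro p q t hp hq
    induction t with
    | zero => simp
    | add x y hx hy => simp only [map_add]; exact B.add_mem hx hy
    | tmul x y => simpa using B.mul_mem (hp x) (hq y)
  refine ⟨B, hA T, fun a ha => ?_, fun b hb => ?_⟩
  · rw [← α.one_act a]
    exact hs a (Finset.mem_insert_of_mem ha) 1
  · induction hb using Algebra.adjoin_induction with
    | mem x hx =>
      intro h
      obtain ⟨a, ha, hi⟩ := Finset.mem_biUnion.1 (Finset.mem_coe.1 hx)
      obtain ⟨i, -, rfl⟩ := Finset.mem_image.1 hi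
      rw [← one_mul (α.act (e i) a), α.act_mul_act]
      exact key _ _ _ (fun h => hs 1 (Finset.mem_insert_self _ _) h) (fun h => hs a ha _)
    | algebraMap c =>
      intro h
      rw [Algebra.algebraMap_eq_smul_one, map_smul]
      exact B.smul_mem (hs 1 (Finset.mem_insert_self _ _) h) _
    | add x y _ _ hx hy =>
      intro h
      rw [map_add]
      exact B.add_mem (hx h) (hy h)
    | mul x y _ _ hx hy =>
      intro h
      -- Writing y as 1 · y makes the axiom give h · (xy) = (h₁ · x)(h₂ · y).
      conv => rw [← α.one_act y]
      rw [α.act_mul_act]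
      exact key _ _ _ hx (fun h => by simpa using hy _)

/-- The partial smash product of a locally finite algebra with a finite-dimensional Hopf algebra
is locally finite. -/
theorem isLocallyFiniteAlgebra_partialSmash [Module.Finite k H]
    (hA : IsLocallyFiniteAlgebra k A) : IsLocallyFiniteAlgebra k α.PartialSmash := by
  classical
  intro s
  have hrep : ∀ x : α.PartialSmash, ∃ S : Finset (A × H), x.val = ∑ i ∈ S, i.1 ⊗ₜ[k] i.2 :=
    fun x => TensorProduct.exists_finset x.val
  choose S hS using hrep
  obtain ⟨B, hBf, hsB, hB⟩ :=
    α.exists_finite_stable_subalgebra hA (s.biUnion fun x => (S x).image Prod.fst)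
  -- W is the image of B ⊗ H: finite-dimensional, and closed under the smash multiplication because
  -- B is a stable subalgebra.
  let W : Submodule k (A ⊗[k] H) := LinearMap.range (B.toSubmodule.subtype.rTensor H)
  have hBf' : Module.Finite k B.toSubmodule := hBf
  have hWf : Module.Finite k W := inferInstance
  have hmem : ∀ a ∈ B, ∀ h : H, a ⊗ₜ[k] h ∈ W := fun a ha h => ⟨(⟨a, ha⟩ : B) ⊗ₜ h, rfl⟩
  have hmul : ∀ x ∈ W, ∀ y ∈ W, α.smashMul x y ∈ W := by
    rintro _ ⟨x, rfl⟩ _ ⟨y, rfl⟩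
    induction x with
    | zero => simp
    | add x x' hx hx' =>
      rw [map_add, map_add, LinearMap.add_apply]; exact W.add_mem hx hx'
    | tmul a h =>
    induction y with
    | zero => simp
    | add y y' hy hy' => rw [map_add, map_add]; exact W.add_mem hy hy'
    | tmul b g =>
      rw [LinearMap.rTensor_tmul, LinearMap.rTensor_tmul, smashMul_tmul]
      generalize Coalgebra.comul (R := k) h = t
      induction t with
      | zero => simp
      | add x y hx hy => rw [map_add]; exact W.add_mem hx hy
      | tmul p q => exact hmem _ (B.mul_mem a.2 (hB _ b.2 p)) _
  let C : Subalgebra k α.PartialSmash :=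
    { carrier := {x | x.val ∈ W}
      mul_mem' := fun {x y} hx hy => hmul _ hx _ hy
      add_mem' := fun {x y} hx hy => W.add_mem hx hy
      algebraMap_mem' := fun c => by
        rw [Algebra.algebraMap_eq_smul_one]
        exact W.smul_mem c (hmem 1 B.one_mem 1) }
  have hC : Module.Finite k C := by
    refine Module.Finite.of_injective
      ({ toFun := fun x => ⟨x.1.val, x.2⟩, map_add' := fun x y => rfl,
         map_smul' := fun c x => rfl } : C →ₗ[k] W) fun x y hxy => ?_
    exact Subtype.ext (PartialSmash.val_injective
      (show x.1.val = y.1.val from congrArg (fun w : W => (w : A ⊗[k] H)) hxy))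
  have hle : Algebra.adjoin k (s : Set α.PartialSmash) ≤ C := by
    refine Algebra.adjoin_le fun x hx => ?_
    change x.val ∈ W
    rw [hS x]
    refine W.sum_mem fun i hi => hmem _ (hsB _ ?_) _
    exact Finset.mem_biUnion.2 ⟨x, Finset.mem_coe.1 hx, Finset.mem_image_of_mem _ hi⟩
  exact Module.Finite.of_injective (Subalgebra.inclusion hle).toLinearMap
    (Subalgebra.inclusion_injective hle)

end LocallyFinite

/-! ### Partial modules as modules over the partial smash product. -/

section Radical

variable {k : Type u} {H : Type v} {A : Type w} [Field k] [Ring H] [HopfAlgebra k H]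
  [Ring A] [Algebra k A] (α : PartialAction k H A)

variable {α} in
/-- The action `(a # h) m = a (h ▹ m)` of `A # H` on a partial module over a quotient of `A`. -/
noncomputable def LeftModule.smashAct {I : Ideal A} [I.IsTwoSided] {hI : α.IsStable I} {M : Type*}
    [AddCommGroup M] [Module k M] [Module (A ⧸ I) M] [IsScalarTower k (A ⧸ I) M]
    (ρ : (α.quotient I hI).LeftModule M) : A ⊗[k] H →ₗ[k] Module.End k M :=
  LinearMap.mul' k (Module.End k M) ∘ₗ TensorProduct.map
    ((Algebra.lsmul k k M).toLinearMap ∘ₗ (Ideal.Quotient.mkₐ k I).toLinearMap) ρ.act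

theorem LeftModule.smashAct_tmul {I : Ideal A} [I.IsTwoSided] {hI : α.IsStable I} {M : Type*}
    [AddCommGroup M] [Module k M] [Module (A ⧸ I) M] [IsScalarTower k (A ⧸ I) M]
    (ρ : (α.quotient I hI).LeftModule M) (a : A) (h : H) (m : M) :
    ρ.smashAct (a ⊗ₜ h) m = Ideal.Quotient.mk I a • ρ.act h m := rfl

/-- On pure tensors this is the partial module axiom for h ▹ (b(g ▹ m)), multiplied on the left by
a. -/
theorem LeftModule.smashAct_smashMul {I : Ideal A} [I.IsTwoSided] {hI : α.IsStable I} {M : Type*}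
    [AddCommGroup M] [Module k M] [Module (A ⧸ I) M] [IsScalarTower k (A ⧸ I) M]
    (ρ : (α.quotient I hI).LeftModule M) (x y : A ⊗[k] H) (m : M) :
    ρ.smashAct (α.smashMul x y) m = ρ.smashAct x (ρ.smashAct y m) := by
  induction x with
  | zero => simp
  | add x x' hx hx' => simp only [map_add, LinearMap.add_apply, hx, hx']
  | tmul a h =>
  induction y with
  | zero => simp
  | add y y' hy hy' => simp only [map_add, LinearMap.add_apply, hy, hy']
  | tmul b g =>
    rw [smashMul_tmul, smashAct_tmul, smashAct_tmul, ρ.act_smul_act]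
    generalize Coalgebra.comul (R := k) h = t
    induction t with
    | zero => simp
    | add x y hx hy => simp only [map_add, LinearMap.add_apply, hx, hy, smul_add]
    | tmul p q =>
      rw [TensorProduct.map_tmul, TensorProduct.map_tmul, smashAct_tmul, TensorProduct.lift.tmul]
      simp only [LinearMap.comp_apply, LinearMap.flip_apply, LinearMap.mulLeft_apply,
        LinearMap.mulRight_apply, map_mul, mul_smul]
      rfl

variable {α} in
/-- A partial module over a quotient of `A` as a representation of the partial smash product. -/
noncomputable def LeftModule.smashRep {I : Ideal A} [I.IsTwoSided] {hI : α.IsStable I} {M : Type*}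
    [AddCommGroup M] [Module k M] [Module (A ⧸ I) M] [IsScalarTower k (A ⧸ I) M]
    (ρ : (α.quotient I hI).LeftModule M) : α.PartialSmash →ₐ[k] Module.End k M :=
  AlgHom.ofLinearMap (ρ.smashAct ∘ₗ PartialSmash.valₗ α)
    (by
      ext m
      change ρ.smashAct (1 ⊗ₜ 1) m = m
      rw [smashAct_tmul, map_one, one_smul, ρ.one_act])
    (fun x y => LinearMap.ext fun m => ρ.smashAct_smashMul α x.val y.val m)

theorem LeftModule.smashRep_toSmash {I : Ideal A} [I.IsTwoSided] {hI : α.IsStable I} {M : Type*}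
    [AddCommGroup M] [Module k M] [Module (A ⧸ I) M] [IsScalarTower k (A ⧸ I) M]
    (ρ : (α.quotient I hI).LeftModule M) (y : A ⊗[k] H) (m : M) :
    ρ.smashRep (α.toSmash y) m = ρ.smashAct y m := by
  change ρ.smashAct (α.smashMul y (1 ⊗ₜ 1)) m = _
  rw [smashAct_smashMul, smashAct_tmul, map_one, one_smul, ρ.one_act]

/-- The images of a # 1 and 1 # h in the partial smash product act as a and as h ▹, so a submodule
over it is a partial submodule. -/
theorem LeftModule.IsIrreducible.isSimpleModule {I : Ideal A} [I.IsTwoSided] {hI : α.IsStable I}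
    {M : Type*} [AddCommGroup M] [Module k M] [Module (A ⧸ I) M] [IsScalarTower k (A ⧸ I) M]
    {ρ : (α.quotient I hI).LeftModule M} (hρ : ρ.IsIrreducible) :
    IsSimpleModule α.PartialSmash (RepModule ρ.smashRep) := by
  have hn : Nontrivial (RepModule ρ.smashRep) := hρ.1
  refine (isSimpleModule_iff _ _).2
    { toNontrivial := inferInstance, eq_bot_or_eq_top := fun N => ?_ }
  let N' : Submodule (A ⧸ I) M :=
    { carrier := {m | (m : RepModule ρ.smashRep) ∈ N}
      add_mem' := fun hx hy => N.add_mem hx hy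
      zero_mem' := N.zero_mem
      smul_mem' := fun a m hm => by
        obtain ⟨a, rfl⟩ := Ideal.Quotient.mk_surjective a
        have h1 := N.smul_mem (α.toSmash (a ⊗ₜ 1)) hm
        have h2 : ρ.smashRep (α.toSmash (a ⊗ₜ 1)) m = Ideal.Quotient.mk I a • m := by
          rw [smashRep_toSmash, smashAct_tmul, ρ.one_act]
        rw [← h2]
        exact h1 }
  have hN' : ∀ (h : H), ∀ m ∈ N', ρ.act h m ∈ N' := fun h m hm => by
    have h1 := N.smul_mem (α.toSmash (1 ⊗ₜ h)) hm
    have h2 : ρ.smashRep (α.toSmash (1 ⊗ₜ h)) m = ρ.act h m := by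
      rw [smashRep_toSmash, smashAct_tmul, map_one, one_smul]
    rw [← h2]
    exact h1
  refine (hρ.2 N' hN').imp (fun h => ?_) (fun h => ?_)
  · rw [eq_bot_iff]
    intro m hm
    have h1 : m ∈ N' := hm
    rw [h] at h1
    exact h1
  · rw [eq_top_iff]
    intro m _
    have h1 : ∀ m : M, m ∈ N' := fun m => by rw [h]; exact Submodule.mem_top
    exact h1 m

/-- The intersection of `A` with the Jacobson radical of the partial smash product is contained in
the `H`-Jacobson radical of `A`. -/
theorem mem_jacobson_of_toSmash_mem {a : A}
    (ha : α.toSmash (a ⊗ₜ 1) ∈ Ring.jacobson α.PartialSmash) : a ∈ α.jacobson := by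
  rw [jacobson, Submodule.mem_sInf]
  rintro I ⟨_, hI, M, _, _, _, _, ρ, hρ, hann⟩
  have hs := hρ.isSimpleModule
  have h1 := Module.mem_annihilator.1 (IsSemisimpleModule.jacobson_le_annihilator _
    (RepModule ρ.smashRep) ha)
  rw [← Ideal.Quotient.eq_zero_iff_mem]
  have h2 : Ideal.Quotient.mk I a ∈ Module.annihilator (A ⧸ I) M := by
    rw [Module.mem_annihilator]
    intro m
    have h3 : ρ.smashRep (α.toSmash (a ⊗ₜ 1)) m = 0 := h1 m
    rwa [LeftModule.smashRep_toSmash, LeftModule.smashAct_tmul, ρ.one_act] at h3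
  rw [hann] at h2
  exact h2

end Radical

end PartialAction

theorem mainTheorem4 {k : Type u} {H : Type v} {A : Type w} [Field k] [Ring H] [HopfAlgebra k H]
    [Ring A] [Algebra k A] (α : PartialAction k H A) (hH : IsSemisimpleRing H)
    (hA : α.IsSemiprimitive) (hfin : IsLocallyFiniteAlgebra k A) :
    Ring.jacobson α.PartialSmash = ⊥ := by
  have := HopfAlgebra.finite_of_isSemisimpleRing k H
  refine α.jacobson_eq_bot_of_stable
    (fun f x hx => α.smashCoaction.coeff_mem_jacobson
      (α.isLocallyFiniteAlgebra_partialSmash hfin) f hx) fun a ha => ?_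
  have h1 := α.mem_jacobson_of_toSmash_mem ha
  rw [hA] at h1
  exact h1
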